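/- Let $n\ge 1$ and let $\Omega\subset\mathbb{R}^n$ be a bounded, open, simply connected (in particular nonempty and path connected) set with Lipschitz boundary. For $1<p<\infty$ let $\Lambda_p^p$, $\Lambda_p\ge 0$, be the first nontrivial Neumann eigenvalue of the $p$-Laplacian, that is, $$\Lambda_p^p=\inf\left\{\frac{\int_\Omega|\nabla v|^p\,dx}{\int_\Omega|v|^p\,dx}\;:\; v\in W^{1,p}(\Omega),\ v\not\equiv 0,\ \int_\Omega|v|^{p-2}v\,dx=0\right\}.$$ For $x,y\in\Omega$ let $d_\Omega(x,y)$ be the intrinsic distance, that is, the infimum of the lengths of the continuous curves in $\Omega$ joining $x$ to $y$, and let $\operatorname{diam}(\Omega)=\sup_{x,y\in\Omega}d_\Omega(x,y)$ be the intrinsic diameter. Then $0<\operatorname{diam}(\Omega)<\infty$ and $$\lim_{p\to\infty}\Lambda_p=\Lambda_\infty:=\frac{2}{\operatorname{diam}(\Omega)}.$$ -/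

import Mathlib

open MeasureTheory Filter Topology Set
open scoped ContDiff ENNReal RealInnerProductSpace

namespace NeumannPLaplace

/-- Euclidean space `ℝⁿ` with the Euclidean norm. -/
abbrev E (n : ℕ) : Type := EuclideanSpace ℝ (Fin n)

/-- `Ω` has Lipschitz boundary: near every boundary point there is a unit direction `ν` such that
`Ω` is the strict epigraph, in the direction `ν`, of a Lipschitz function of the coordinates
orthogonal to `ν`. -/
def HasLipschitzBoundary {n : ℕ} (Ω : Set (E n)) : Prop :=
  ∀ z ∈ frontier Ω, ∃ ν : E n, ‖ν‖ = 1 ∧ ∃ (K : NNReal) (g : (Submodule.span ℝ {ν})ᗮ → ℝ),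
    LipschitzWith K g ∧
      ∀ᶠ x in 𝓝 z, x ∈ Ω ↔ g ((Submodule.span ℝ {ν})ᗮ.orthogonalProjectionOnto x) < ⟪ν, x⟫

/-- The intrinsic (geodesic) distance of `x` and `y` in `Ω`: the infimum of the lengths of the
continuous curves in `Ω` that join `x` to `y`. -/
noncomputable def intrinsicDist {n : ℕ} (Ω : Set (E n)) (x y : E n) : ℝ≥0∞ :=
  ⨅ (γ : ℝ → E n) (_ : ContinuousOn γ (Icc 0 1) ∧ MapsTo γ (Icc 0 1) Ω ∧ γ 0 = x ∧ γ 1 = y),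
    eVariationOn γ (Icc 0 1)

/-- The intrinsic diameter of `Ω`. -/
noncomputable def intrinsicDiam {n : ℕ} (Ω : Set (E n)) : ℝ≥0∞ :=
  ⨆ (x ∈ Ω) (y ∈ Ω), intrinsicDist Ω x y

/-- `G` is the weak gradient of `v` in `Ω`: both are locally integrable in `Ω`, and
`∫_Ω v ∂ₑφ = - ∫_Ω ⟨G, e⟩ φ` for all directions `e` and all test functions `φ ∈ C_c^∞(Ω)`. -/
def HasWeakGradientOn {n : ℕ} (Ω : Set (E n)) (v : E n → ℝ) (G : E n → E n) : Prop :=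
  LocallyIntegrableOn v Ω ∧ LocallyIntegrableOn G Ω ∧
    ∀ φ : E n → ℝ, ContDiff ℝ ∞ φ → HasCompactSupport φ → tsupport φ ⊆ Ω → ∀ e : E n,
      ∫ x in Ω, v x * fderiv ℝ φ x e = -∫ x in Ω, ⟪G x, e⟫ * φ x

/-- `v ∈ W^{1,p}(Ω)`, with weak gradient `G`. -/
def MemW1p {n : ℕ} (Ω : Set (E n)) (p : ℝ) (v : E n → ℝ) (G : E n → E n) : Prop :=
  MemLp v (ENNReal.ofReal p) (volume.restrict Ω) ∧
    MemLp G (ENNReal.ofReal p) (volume.restrict Ω) ∧ HasWeakGradientOn Ω v G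

/-- The set of values `∫_Ω |∇v|^p / ∫_Ω |v|^p` of the Rayleigh quotient over the nonzero
`v ∈ W^{1,p}(Ω)` that satisfy `∫_Ω |v|^{p-2} v = 0`. -/
def rayleighValues {n : ℕ} (Ω : Set (E n)) (p : ℝ) : Set ℝ :=
  {r | ∃ (v : E n → ℝ) (G : E n → E n), MemW1p Ω p v G ∧ ¬ (v =ᵐ[volume.restrict Ω] 0) ∧
    ∫ x in Ω, |v x| ^ (p - 2) * v x = 0 ∧
    r = (∫ x in Ω, ‖G x‖ ^ p) / ∫ x in Ω, |v x| ^ p}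

/-- The first nontrivial Neumann eigenvalue `Λ_p^p` of `-Δ_p` on `Ω`, `1 < p < ∞`, by its
variational definition. -/
noncomputable def neumannEigenvalue {n : ℕ} (Ω : Set (E n)) (p : ℝ) : ℝ :=
  sInf (rayleighValues Ω p)

/-- `Λ_p`, the `p`-th root of the first nontrivial Neumann eigenvalue of `-Δ_p` on `Ω`. -/
noncomputable def neumannLambda {n : ℕ} (Ω : Set (E n)) (p : ℝ) : ℝ :=
  (neumannEigenvalue Ω p) ^ (1 / p)

end NeumannPLaplace

/- Lower bound on `Λ_p`. Let `v` have weak gradient `G`. Well inside `Ω`, a mollification of `v` at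
a fixed scale has gradient at most a constant to the power `1 / p` times `‖G‖_p`, so up to a factor
tending to `1` its oscillation is at most `‖G‖_p` times the lengths of the curves that join two
points. The uniform cone condition allows moving all of `Ω` inward by `O(ε)`, at a cost
`O(ε) ‖G‖_p`. Hence some constant is within about `‖G‖_p diam Ω / 2` of `v` in `L^p`, and the
normalization of `v` makes `0` the best such constant.

Upper bound on `Λ_p`. The intrinsic distance to a point is locally `1`-Lipschitz, and for any
`2 s < diam Ω` one can choose the point so that, whichever constant is subtracted, the result is at
least `s` in absolute value on a set of measure bounded below uniformly in `p`. -/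

namespace NeumannPLaplace

section IntrinsicDist

variable {n : ℕ} {Ω : Set (E n)} {x y : E n}

lemma edist_le_intrinsicDist (Ω : Set (E n)) (x y : E n) :
    edist x y ≤ intrinsicDist Ω x y := by
  refine le_iInf₂ fun γ ⟨_, _, h0, h1⟩ => ?_
  rw [← h0, ← h1]
  exact eVariationOn.edist_le γ (by simp) (by simp)

lemma intrinsicDist_le_eVariationOn {γ : ℝ → E n} (hγ : ContinuousOn γ (Icc 0 1))
    (hγΩ : MapsTo γ (Icc 0 1) Ω) : intrinsicDist Ω (γ 0) (γ 1) ≤ eVariationOn γ (Icc 0 1) :=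
  iInf₂_le γ ⟨hγ, hγΩ, rfl, rfl⟩

lemma eVariationOn_lineMap_le {V : Type*} [NormedAddCommGroup V] [NormedSpace ℝ V] (x y : V) :
    eVariationOn (AffineMap.lineMap x y : ℝ → V) (Icc 0 1) ≤ edist x y := by
  have h_id : eVariationOn (id : ℝ → ℝ) (Icc 0 1) = 1 := by
    have h := (monotone_id.monotoneOn (Icc (0 : ℝ) 1)).eVariationOn_eq
      (left_mem_Icc.2 zero_le_one) (right_mem_Icc.2 zero_le_one)
    simpa only [inter_self, id, sub_zero, ENNReal.ofReal_one] using h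
  have h := ((lipschitzWith_lineMap x y).lipschitzOnWith (s := univ)).comp_eVariationOn_le
    (g := (id : ℝ → ℝ)) (s := Icc 0 1) (mapsTo_univ _ _)
  rwa [h_id, mul_one, ← edist_nndist] at h

lemma intrinsicDist_le_edist (h : segment ℝ x y ⊆ Ω) : intrinsicDist Ω x y ≤ edist x y := by
  have hΩ : MapsTo (AffineMap.lineMap x y : ℝ → E n) (Icc 0 1) Ω := fun t ht =>
    h (segment_eq_image_lineMap ℝ x y ▸ mem_image_of_mem _ ht)
  have h_le := intrinsicDist_le_eVariationOn AffineMap.lineMap_continuous.continuousOn hΩ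
  rw [AffineMap.lineMap_apply_zero, AffineMap.lineMap_apply_one] at h_le
  exact h_le.trans (eVariationOn_lineMap_le x y)

lemma intrinsicDist_le_swap (Ω : Set (E n)) (x y : E n) :
    intrinsicDist Ω x y ≤ intrinsicDist Ω y x := by
  refine le_iInf₂ fun γ ⟨hc, hm, h0, h1⟩ => ?_
  have h_refl : MapsTo (fun t : ℝ => 1 - t) (Icc 0 1) (Icc 0 1) := fun t ht => by
    constructor <;> linarith [ht.1, ht.2]
  have h := intrinsicDist_le_eVariationOn (hc.comp (by fun_prop) h_refl) (hm.comp h_refl)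
  simp only [Function.comp_apply, sub_zero, sub_self, h0, h1] at h
  exact h.trans <|
    eVariationOn.comp_le_of_antitoneOn γ _ (fun a _ b _ hab => sub_le_sub_left hab 1) h_refl

lemma intrinsicDist_comm (Ω : Set (E n)) (x y : E n) :
    intrinsicDist Ω x y = intrinsicDist Ω y x :=
  le_antisymm (intrinsicDist_le_swap Ω x y) (intrinsicDist_le_swap Ω y x)

/-- The concatenation of two curves parametrized by `[0, 1]`, each run at double speed. -/
noncomputable def concatCurve {α : Type*} (γ η : ℝ → α) (t : ℝ) : α :=
  if t ≤ 1 / 2 then γ (2 * t) else η (2 * t - 1)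

section Concat

variable {α : Type*} {γ η : ℝ → α}

lemma concatCurve_eqOn_left (γ η : ℝ → α) :
    EqOn (concatCurve γ η) (γ ∘ fun t => 2 * t) (Icc 0 (1 / 2)) :=
  fun _ ht => if_pos ht.2

lemma concatCurve_eqOn_right (h : γ 1 = η 0) :
    EqOn (concatCurve γ η) (η ∘ fun t => 2 * t - 1) (Icc (1 / 2) 1) := fun t ht => by
  rcases ht.1.eq_or_lt with rfl | hlt
  · norm_num [concatCurve, h]
  · exact if_neg hlt.not_ge

lemma mapsTo_two_mul : MapsTo (fun t : ℝ => 2 * t) (Icc 0 (1 / 2)) (Icc 0 1) := fun t ht => by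
  constructor <;> linarith [ht.1, ht.2]

lemma mapsTo_two_mul_sub_one :
    MapsTo (fun t : ℝ => 2 * t - 1) (Icc (1 / 2) 1) (Icc 0 1) := fun t ht => by
  constructor <;> linarith [ht.1, ht.2]

lemma Icc_zero_one_eq_union_halves : Icc (0 : ℝ) 1 = Icc 0 (1 / 2) ∪ Icc (1 / 2) 1 :=
  (Icc_union_Icc_eq_Icc (by norm_num) (by norm_num)).symm

lemma concatCurve_mapsTo {s : Set α} (hγ : MapsTo γ (Icc 0 1) s) (hη : MapsTo η (Icc 0 1) s)
    (h : γ 1 = η 0) : MapsTo (concatCurve γ η) (Icc 0 1) s := by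
  rw [Icc_zero_one_eq_union_halves]
  exact ((hγ.comp mapsTo_two_mul).congr (concatCurve_eqOn_left γ η).symm).union
    ((hη.comp mapsTo_two_mul_sub_one).congr (concatCurve_eqOn_right h).symm)

lemma concatCurve_continuousOn [TopologicalSpace α] (hγ : ContinuousOn γ (Icc 0 1))
    (hη : ContinuousOn η (Icc 0 1)) (h : γ 1 = η 0) :
    ContinuousOn (concatCurve γ η) (Icc 0 1) := by
  rw [Icc_zero_one_eq_union_halves]
  exact ((hγ.comp (by fun_prop) mapsTo_two_mul).congr
    (concatCurve_eqOn_left γ η)).union_of_isClosed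
      ((hη.comp (by fun_prop) mapsTo_two_mul_sub_one).congr (concatCurve_eqOn_right h))
      isClosed_Icc isClosed_Icc

lemma eVariationOn_concatCurve_le [PseudoEMetricSpace α] (h : γ 1 = η 0) :
    eVariationOn (concatCurve γ η) (Icc 0 1) ≤
      eVariationOn γ (Icc 0 1) + eVariationOn η (Icc 0 1) := by
  have h_add := eVariationOn.Icc_add_Icc (concatCurve γ η) (s := univ) (a := (0 : ℝ)) (b := 1 / 2)
    (c := 1) (by norm_num) (by norm_num) (mem_univ _)
  simp only [univ_inter] at h_add
  rw [← h_add, eVariationOn.congr (concatCurve_eqOn_left γ η),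
    eVariationOn.congr (concatCurve_eqOn_right h)]
  gcongr
  · exact eVariationOn.comp_le_of_monotoneOn γ _ (fun a _ b _ hab => by simpa using hab)
      mapsTo_two_mul
  · exact eVariationOn.comp_le_of_monotoneOn η _ (fun a _ b _ hab => by simpa using hab)
      mapsTo_two_mul_sub_one

end Concat

lemma intrinsicDist_triangle (Ω : Set (E n)) (x y z : E n) :
    intrinsicDist Ω x z ≤ intrinsicDist Ω x y + intrinsicDist Ω y z := by
  conv_rhs => unfold intrinsicDist
  refine ENNReal.le_iInf₂_add_iInf₂ fun γ ⟨hγ, hγΩ, hγ0, hγ1⟩ η ⟨hη, hηΩ, hη0, hη1⟩ => ?_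
  have h : γ 1 = η 0 := hγ1.trans hη0.symm
  have h_le := intrinsicDist_le_eVariationOn (concatCurve_continuousOn hγ hη h)
    (concatCurve_mapsTo hγΩ hηΩ h)
  rw [concatCurve_eqOn_left γ η (by norm_num), concatCurve_eqOn_right h (by norm_num)] at h_le
  norm_num [hγ0, hη1] at h_le
  exact h_le.trans (eVariationOn_concatCurve_le h)

lemma eventually_intrinsicDist_le_edist (hopen : IsOpen Ω) (hx : x ∈ Ω) :
    ∀ᶠ w : E n × E n in 𝓝 (x, x), intrinsicDist Ω w.1 w.2 ≤ edist w.1 w.2 := by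
  obtain ⟨r, hr, hrΩ⟩ := Metric.isOpen_iff.1 hopen x hx
  filter_upwards [prod_mem_nhds (Metric.ball_mem_nhds x hr) (Metric.ball_mem_nhds x hr)]
    with w ⟨hw1, hw2⟩
  exact intrinsicDist_le_edist (((convex_ball x r).segment_subset hw1 hw2).trans hrΩ)

lemma intrinsicDist_lt_top (hopen : IsOpen Ω) (hconn : IsPreconnected Ω) (hx : x ∈ Ω)
    (hy : y ∈ Ω) : intrinsicDist Ω x y < ⊤ := by
  refine hconn.induction₂ (fun a b => intrinsicDist Ω a b < ⊤) (fun a ha => ?_)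
    (fun a b c _ _ _ hab hbc =>
      (intrinsicDist_triangle Ω a b c).trans_lt (ENNReal.add_lt_top.2 ⟨hab, hbc⟩))
    (fun a b _ _ hab => intrinsicDist_comm Ω a b ▸ hab) hx hy
  have h_near : ∀ᶠ b in 𝓝 a, intrinsicDist Ω a b ≤ edist a b :=
    (Continuous.prodMk_right a).tendsto a |>.eventually (eventually_intrinsicDist_le_edist hopen ha)
  filter_upwards [nhdsWithin_le_nhds h_near] with b hb
  exact hb.trans_lt (edist_lt_top a b)

lemma exists_lipschitzOnWith_toReal_intrinsicDist (hopen : IsOpen Ω) (hconn : IsPreconnected Ω)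
    (hx : x ∈ Ω) (hy : y ∈ Ω) :
    ∃ U ∈ 𝓝 y, LipschitzOnWith 1 (fun z => (intrinsicDist Ω x z).toReal) U := by
  have h_fin {z : E n} (hz : z ∈ Ω) := intrinsicDist_lt_top hopen hconn hx hz
  obtain ⟨U, hU, hU_le⟩ : ∃ U ∈ 𝓝 y, ∀ a ∈ U, ∀ b ∈ U, intrinsicDist Ω a b ≤ edist a b := by
    have h_near := eventually_intrinsicDist_le_edist hopen hy
    rw [nhds_prod_eq, Filter.eventually_iff, mem_prod_same_iff] at h_near
    simpa only [prod_subset_iff, mem_ofPred_eq] using h_near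
  refine ⟨U ∩ Ω, inter_mem hU (hopen.mem_nhds hy), LipschitzOnWith.of_le_add ?_⟩
  rintro a ⟨haU, -⟩ b ⟨hbU, hbΩ⟩
  have h_le : intrinsicDist Ω x a ≤ intrinsicDist Ω x b + edist b a :=
    (intrinsicDist_triangle Ω x b a).trans (by gcongr; exact hU_le b hbU a haU)
  have h_toReal := ENNReal.toReal_mono
    (ENNReal.add_ne_top.2 ⟨(h_fin hbΩ).ne, edist_ne_top b a⟩) h_le
  rwa [ENNReal.toReal_add (h_fin hbΩ).ne (edist_ne_top b a), ← dist_edist, dist_comm] at h_toReal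

lemma continuousOn_toReal_intrinsicDist (hopen : IsOpen Ω) (hconn : IsPreconnected Ω)
    (hx : x ∈ Ω) : ContinuousOn (fun z => (intrinsicDist Ω x z).toReal) Ω := fun y hy => by
  obtain ⟨U, hU, h_lip⟩ := exists_lipschitzOnWith_toReal_intrinsicDist hopen hconn hx hy
  exact (h_lip.continuousOn.continuousAt hU).continuousWithinAt

lemma exists_intrinsicDist_le_of_isCompact (hopen : IsOpen Ω) (hconn : IsPreconnected Ω)
    (hx : x ∈ Ω) {K : Set (E n)} (hK : IsCompact K) (hKΩ : K ⊆ Ω) :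
    ∃ M < ⊤, ∀ y ∈ K, intrinsicDist Ω x y ≤ M := by
  obtain ⟨M, hM⟩ := hK.bddAbove_image
    ((continuousOn_toReal_intrinsicDist hopen hconn hx).mono hKΩ)
  refine ⟨ENNReal.ofReal M, ENNReal.ofReal_lt_top, fun y hy => ?_⟩
  exact (ENNReal.le_ofReal_iff_toReal_le (intrinsicDist_lt_top hopen hconn hx (hKΩ hy)).ne
    (ENNReal.toReal_nonneg.trans (hM (mem_image_of_mem _ hy)))).2 (hM (mem_image_of_mem _ hy))

end IntrinsicDist

section ConeCondition

variable {V : Type*} [NormedAddCommGroup V]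

/-- The points of `Ω` from which all the segments `{x + s • w | 0 ≤ s ≤ c}` with `‖w - ν‖ ≤ c` run
inside `Ω`: a whole cone with vertex `x` and axis `ν` lies in `Ω`. -/
def coneSet [Module ℝ V] (Ω : Set V) (c : ℝ) (ν : V) : Set V :=
  {x | ∀ s ∈ Icc 0 c, ∀ w ∈ Metric.closedBall ν c, x + s • w ∈ Ω}

/-- Adams' uniform interior cone condition: finitely many congruent cones suffice to place a cone
inside `Ω` at every point of `Ω`. -/
def UniformConeCondition [Module ℝ V] (Ω : Set V) : Prop :=
  ∃ c > 0, ∃ S : Finset V, Ω ⊆ ⋃ ν ∈ S, coneSet Ω c ν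

variable [NormedSpace ℝ V] {Ω : Set V} {c : ℝ} {ν x : V}

lemma coneSet_subset (hc : 0 ≤ c) : coneSet Ω c ν ⊆ Ω := fun x hx => by
  simpa using hx 0 (left_mem_Icc.2 hc) ν (Metric.mem_closedBall_self hc)

lemma coneSet_anti {c' : ℝ} (h : c ≤ c') : coneSet Ω c' ν ⊆ coneSet Ω c ν := fun _ hx s hs w hw =>
  hx s (Icc_subset_Icc_right h hs) w (Metric.closedBall_subset_closedBall h hw)

lemma isOpen_coneSet [ProperSpace V] (hopen : IsOpen Ω) : IsOpen (coneSet Ω c ν) := by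
  have h_eq : coneSet Ω c ν =
      {x | ∀ q ∈ Icc 0 c ×ˢ Metric.closedBall ν c, x + q.1 • q.2 ∈ Ω} := by
    ext x
    exact ⟨fun h q hq => h q.1 hq.1 q.2 hq.2, fun h s hs w hw => h (s, w) ⟨hs, hw⟩⟩
  rw [h_eq, isOpen_iff_eventually]
  intro x hx
  refine (isCompact_Icc.prod (isCompact_closedBall ν c)).eventually_forall_of_forall_eventually
    fun q hq => ?_
  have h_cont : Continuous fun z : V × ℝ × V => z.1 + z.2.1 • z.2.2 := by fun_prop
  exact h_cont.continuousAt.eventually (hopen.mem_nhds (hx q hq))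

lemma norm_smul_le_of_mem_closedBall {s : ℝ} {w : V} (hs : s ∈ Icc 0 c)
    (hw : w ∈ Metric.closedBall ν c) : ‖s • w‖ ≤ c * (‖ν‖ + c) := by
  have hw' : ‖w‖ ≤ ‖ν‖ + c :=
    (norm_le_norm_add_norm_sub' w ν).trans (by gcongr; exact mem_closedBall_iff_norm.1 hw)
  rw [norm_smul, Real.norm_of_nonneg hs.1]
  exact mul_le_mul hs.2 hw' (norm_nonneg w) (hs.1.trans hs.2)

lemma eventually_coneSet_mem_nhds (ν : V) {U : Set V} {z : V} (hU : U ∈ 𝓝 z) :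
    ∀ᶠ c in 𝓝[>] (0 : ℝ), coneSet U c ν ∈ 𝓝 z := by
  obtain ⟨ρ, hρ, hρU⟩ := Metric.mem_nhds_iff.1 hU
  have h_small : ∀ᶠ c : ℝ in 𝓝 0, c * (‖ν‖ + c) < ρ / 2 :=
    (by fun_prop : Continuous fun c : ℝ => c * (‖ν‖ + c)).continuousAt.eventually
      (gt_mem_nhds (by simpa using hρ))
  filter_upwards [nhdsWithin_le_nhds h_small] with c hc
  filter_upwards [Metric.ball_mem_nhds z (half_pos hρ)] with x hx s hs w hw
  refine hρU (mem_ball_iff_norm.2 ?_)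
  rw [mem_ball_iff_norm] at hx
  rw [add_sub_right_comm]
  linarith [norm_add_le (x - z) (s • w), norm_smul_le_of_mem_closedBall hs hw]

lemma segment_subset_of_mem_coneSet {w : V} (hc : 0 ≤ c) (hx : x ∈ coneSet Ω c ν)
    (hw : w ∈ Metric.closedBall ν c) : segment ℝ x (x + c • w) ⊆ Ω := by
  rw [segment_eq_image']
  rintro _ ⟨s, hs, rfl⟩
  simpa only [add_sub_cancel_left, smul_smul] using
    hx (s * c) ⟨mul_nonneg hs.1 hc, mul_le_of_le_one_left hc hs.2⟩ w hw

/-- The inner parallel set of `Ω` at distance `δ`. -/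
def innerParallelSet {X : Type*} [PseudoMetricSpace X] (Ω : Set X) (δ : ℝ) : Set X :=
  {x | Metric.ball x δ ⊆ Ω}

section InnerParallelSet

variable {X : Type*} [PseudoMetricSpace X] {Ω : Set X} {δ : ℝ}

lemma innerParallelSet_subset (hδ : 0 < δ) : innerParallelSet Ω δ ⊆ Ω :=
  fun _ hx => hx (Metric.mem_ball_self hδ)

lemma innerParallelSet_anti {δ' : ℝ} (h : δ ≤ δ') :
    innerParallelSet Ω δ' ⊆ innerParallelSet Ω δ :=
  fun _ hx => (Metric.ball_subset_ball h).trans hx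

lemma isClosed_innerParallelSet : IsClosed (innerParallelSet Ω δ) :=
  isClosed_of_closure_subset fun x hx y hy => by
    obtain ⟨x', hx', h⟩ := Metric.mem_closure_iff.1 hx (δ - dist y x) (by simpa using hy)
    exact hx' (Metric.mem_ball.2 (by linarith [dist_triangle y x x']))

lemma isCompact_innerParallelSet [ProperSpace X] (hbdd : Bornology.IsBounded Ω) (hδ : 0 < δ) :
    IsCompact (innerParallelSet Ω δ) :=
  Metric.isCompact_of_isClosed_isBounded isClosed_innerParallelSet
    (hbdd.subset (innerParallelSet_subset hδ))

end InnerParallelSet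

lemma add_smul_mem_innerParallelSet (hc : 0 < c) (hx : x ∈ coneSet Ω c ν) :
    x + c • ν ∈ innerParallelSet Ω (c * c) := fun y hy => by
  have hw : c⁻¹ • (y - x) ∈ Metric.closedBall ν c := by
    have h_eq : c⁻¹ • (y - x) - ν = c⁻¹ • (y - (x + c • ν)) := by
      rw [← sub_sub, smul_sub _ (y - x), inv_smul_smul₀ hc.ne']
    rw [mem_closedBall_iff_norm, h_eq, norm_smul, norm_inv, Real.norm_of_nonneg hc.le,
      inv_mul_le_iff₀ hc]
    exact (mem_ball_iff_norm.1 hy).le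
  simpa [smul_inv_smul₀ hc.ne'] using hx c (right_mem_Icc.2 hc.le) _ hw

end ConeCondition

section LipschitzBoundary

variable {V : Type*} [NormedAddCommGroup V] [InnerProductSpace ℝ V]

lemma lt_inner_add_smul_of_lipschitzWith {ν : V} (hν : ‖ν‖ = 1) {K : NNReal}
    {g : (Submodule.span ℝ {ν})ᗮ → ℝ} (hg : LipschitzWith K g) {c s : ℝ} (hc : c * (K + 1) ≤ 1)
    (hs : 0 ≤ s) {w x : V} (hw : w ∈ Metric.closedBall ν c)
    (hx : g ((Submodule.span ℝ {ν})ᗮ.orthogonalProjectionOnto x) < ⟪ν, x⟫) :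
    g ((Submodule.span ℝ {ν})ᗮ.orthogonalProjectionOnto (x + s • w)) < ⟪ν, x + s • w⟫ := by
  set P := (Submodule.span ℝ {ν})ᗮ.orthogonalProjectionOnto
  rw [mem_closedBall_iff_norm] at hw
  have hPν : P ν = 0 := Submodule.orthogonalProjectionOnto_apply_of_mem_orthogonal <| by
    rw [Submodule.orthogonal_orthogonal]
    exact Submodule.mem_span_singleton_self ν
  have hPw : ‖P w‖ ≤ c := by
    rw [show P w = P (w - ν) by rw [map_sub, hPν, sub_zero]]
    exact (Submodule.norm_orthogonalProjectionOnto_apply_le _ _).trans hw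
  have h_graph : g (P (x + s • w)) ≤ g (P x) + K * (s * c) := by
    have h := hg.le_add_mul (P (x + s • w)) (P x)
    rw [dist_eq_norm, map_add, add_sub_cancel_left, map_smul, norm_smul,
      Real.norm_of_nonneg hs] at h
    rw [map_add, map_smul]
    exact h.trans (by gcongr)
  have h_height : 1 - c ≤ ⟪ν, w⟫ := by
    have h_eq : ⟪ν, w⟫ = 1 + ⟪ν, w - ν⟫ := by
      rw [inner_sub_right, real_inner_self_eq_norm_sq, hν]; ring
    have h_abs : |⟪ν, w - ν⟫| ≤ c := (abs_real_inner_le_norm _ _).trans (by rwa [hν, one_mul])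
    linarith [neg_le_of_abs_le h_abs]
  rw [inner_add_right, inner_smul_right]
  nlinarith [mul_le_mul_of_nonneg_left hc hs, mul_le_mul_of_nonneg_left h_height hs]

lemma HasLipschitzBoundary.exists_nhds_inter_subset_coneSet {n : ℕ} {Ω : Set (E n)}
    (hLip : HasLipschitzBoundary Ω) (hopen : IsOpen Ω) {z : E n} (hz : z ∈ closure Ω) :
    ∃ U ∈ 𝓝 z, ∃ c > 0, ∃ ν, Ω ∩ U ⊆ coneSet Ω c ν := by
  by_cases hzΩ : z ∈ Ω
  · obtain ⟨c, hcU, hc⟩ :=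
      ((eventually_coneSet_mem_nhds 0 (hopen.mem_nhds hzΩ)).and self_mem_nhdsWithin).exists
    exact ⟨coneSet Ω c 0, hcU, c, hc, 0, inter_subset_right⟩
  obtain ⟨ν, hν, K, g, hg, h_epi⟩ := hLip z (hopen.frontier_eq ▸ ⟨hz, hzΩ⟩)
  have h_small : ∀ᶠ c : ℝ in 𝓝 0, c * (K + 1) < 1 :=
    (by fun_prop : Continuous fun c : ℝ => c * ((K : ℝ) + 1)).continuousAt.eventually
      (gt_mem_nhds (by simp))
  obtain ⟨c, ⟨hcU, hcK⟩, hc⟩ := (((eventually_coneSet_mem_nhds ν h_epi).and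
    (nhdsWithin_le_nhds h_small)).and self_mem_nhdsWithin).exists
  refine ⟨_, hcU, c, hc, ν, fun x ⟨hxΩ, hxU⟩ s hs w hw => (hxU s hs w hw).2 ?_⟩
  exact lt_inner_add_smul_of_lipschitzWith hν hg hcK.le hs.1 hw
    ((coneSet_subset hc.le hxU).1 hxΩ)

lemma HasLipschitzBoundary.uniformConeCondition {n : ℕ} {Ω : Set (E n)}
    (hLip : HasLipschitzBoundary Ω) (hopen : IsOpen Ω) (hbdd : Bornology.IsBounded Ω) :
    UniformConeCondition Ω := by
  suffices h : ∃ c > 0, ∃ S : Finset (E n), Ω ∩ closure Ω ⊆ ⋃ ν ∈ S, coneSet Ω c ν by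
    rwa [inter_eq_left.2 subset_closure] at h
  refine hbdd.isCompact_closure.induction_on
    (p := fun s => ∃ c > 0, ∃ S : Finset (E n), Ω ∩ s ⊆ ⋃ ν ∈ S, coneSet Ω c ν)
    ⟨1, one_pos, ∅, by simp⟩ ?_ ?_ fun z hz => ?_
  · rintro s t hst ⟨c, hc, S, hS⟩
    exact ⟨c, hc, S, (inter_subset_inter_right Ω hst).trans hS⟩
  · classical
    rintro s t ⟨c, hc, S, hS⟩ ⟨d, hd, T, hT⟩
    refine ⟨min c d, lt_min hc hd, S ∪ T, ?_⟩
    rw [Finset.set_biUnion_union, inter_union_distrib_left]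
    exact union_subset_union
      (hS.trans (iUnion₂_mono fun _ _ => coneSet_anti (min_le_left c d)))
      (hT.trans (iUnion₂_mono fun _ _ => coneSet_anti (min_le_right c d)))
  · obtain ⟨U, hU, c, hc, ν, h⟩ := hLip.exists_nhds_inter_subset_coneSet hopen hz
    exact ⟨U, mem_nhdsWithin_of_mem_nhds hU, c, hc, {ν}, by simpa using h⟩

end LipschitzBoundary

section IntrinsicDiam

variable {n : ℕ} {Ω : Set (E n)} {x y : E n}

lemma intrinsicDist_le_intrinsicDiam (hx : x ∈ Ω) (hy : y ∈ Ω) :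
    intrinsicDist Ω x y ≤ intrinsicDiam Ω :=
  le_iSup₂_of_le x hx (le_iSup₂_of_le y hy le_rfl)

lemma intrinsicDiam_pos [Nontrivial (E n)] (hopen : IsOpen Ω) (hne : Ω.Nonempty) :
    0 < intrinsicDiam Ω := by
  obtain ⟨x, hx, y, hy, hxy⟩ := (infinite_of_mem_nhds hne.some
    (hopen.mem_nhds hne.some_mem)).nontrivial
  exact (edist_pos.2 hxy).trans_le
    ((edist_le_intrinsicDist Ω x y).trans (intrinsicDist_le_intrinsicDiam hx hy))

lemma intrinsicDiam_lt_top (hopen : IsOpen Ω) (hbdd : Bornology.IsBounded Ω)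
    (hconn : IsConnected Ω) (hcone : UniformConeCondition Ω) : intrinsicDiam Ω < ⊤ := by
  obtain ⟨x₀, hx₀⟩ := hconn.nonempty
  obtain ⟨c, hc, S, hS⟩ := hcone
  obtain ⟨M, hM, h_inner⟩ := exists_intrinsicDist_le_of_isCompact hopen hconn.isPreconnected hx₀
    (isCompact_innerParallelSet hbdd (mul_pos hc hc)) (innerParallelSet_subset (mul_pos hc hc))
  set B := M + ∑ ν ∈ S, ‖c • ν‖ₑ
  have hB : B < ⊤ := ENNReal.add_lt_top.2 ⟨hM, ENNReal.sum_lt_top.2 fun _ _ => enorm_lt_top⟩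
  have h_le : ∀ x ∈ Ω, intrinsicDist Ω x₀ x ≤ B := fun x hx => by
    obtain ⟨ν, hν, hxν⟩ := mem_iUnion₂.1 (hS hx)
    refine (intrinsicDist_triangle Ω x₀ (x + c • ν) x).trans (add_le_add ?_ ?_)
    · exact h_inner _ (add_smul_mem_innerParallelSet hc hxν)
    · rw [intrinsicDist_comm]
      refine (intrinsicDist_le_edist <|
        segment_subset_of_mem_coneSet hc.le hxν (Metric.mem_closedBall_self hc.le)).trans ?_
      rw [edist_comm, edist_eq_enorm_sub, add_sub_cancel_left]
      exact Finset.single_le_sum_of_canonicallyOrdered (f := fun ν => ‖c • ν‖ₑ) hν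
  refine (iSup₂_le fun x hx => iSup₂_le fun y hy => ?_).trans_lt (ENNReal.add_lt_top.2 ⟨hB, hB⟩)
  refine (intrinsicDist_triangle Ω x x₀ y).trans (add_le_add ?_ (h_le y hy))
  exact intrinsicDist_comm Ω x₀ x ▸ h_le x hx

end IntrinsicDiam

section Oscillation

lemma edist_le_mul_eVariationOn {X Y : Type*} [PseudoEMetricSpace X] [PseudoEMetricSpace Y]
    {γ : ℝ → X} {η : ℝ → Y} {L : ℝ≥0∞} {τ : ℝ} (hτ : 0 < τ)
    (h : ∀ s ∈ Icc (0 : ℝ) 1, ∀ t ∈ Icc (0 : ℝ) 1, dist s t < τ →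
      edist (η s) (η t) ≤ L * edist (γ s) (γ t)) :
    edist (η 0) (η 1) ≤ L * eVariationOn γ (Icc 0 1) := by
  obtain ⟨N, hN⟩ := exists_nat_one_div_lt hτ
  set u : ℕ → ℝ := fun i => i / (N + 1 : ℕ)
  have hu_mono : Monotone u := fun i j hij => by simp only [u]; gcongr
  have hu_mem : ∀ i ≤ N + 1, u i ∈ Icc (0 : ℝ) 1 := fun i hi =>
    ⟨by positivity, div_le_one_of_le₀ (by exact_mod_cast hi) (by positivity)⟩
  have hu_dist : ∀ i, dist (u i) (u (i + 1)) < τ := fun i => by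
    have h_eq : u (i + 1) = u i + 1 / ((N : ℝ) + 1) := by simp only [u]; push_cast; ring
    rwa [h_eq, dist_self_add_right, Real.norm_of_nonneg (by positivity)]
  calc edist (η 0) (η 1) = edist (η (u 0)) (η (u (N + 1))) := by
        simp only [u, Nat.cast_zero, zero_div]
        rw [div_self (by positivity)]
    _ ≤ ∑ i ∈ Finset.range (N + 1), L * edist (γ (u (i + 1))) (γ (u i)) :=
        edist_le_range_sum_of_edist_le (f := fun i => η (u i)) (N + 1) fun {i} hi => by
          rw [edist_comm (γ _)]
          exact h _ (hu_mem i hi.le) _ (hu_mem _ hi) (hu_dist i)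
    _ = L * ∑ i ∈ Finset.range (N + 1), edist (γ (u (i + 1))) (γ (u i)) :=
        (Finset.mul_sum _ _ _).symm
    _ ≤ L * eVariationOn γ (Icc 0 1) := by
        gcongr
        exact eVariationOn.sum_le_of_monotoneOn_Iic (hu_mono.monotoneOn _) hu_mem

variable {Y : Type*} [PseudoEMetricSpace Y]

/-- `f` is `L`-Lipschitz along the segments that stay at depth at least `δ` inside `Ω`. -/
def LipschitzAtDepth {V : Type*} [SeminormedAddCommGroup V] [Module ℝ V] (Ω : Set V) (δ : ℝ)
    (L : ℝ≥0∞) (f : V → Y) : Prop :=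
  ∀ x y, segment ℝ x y ⊆ innerParallelSet Ω δ → edist (f x) (f y) ≤ L * edist x y

lemma LipschitzAtDepth.mono {V : Type*} [SeminormedAddCommGroup V] [Module ℝ V] {Ω : Set V}
    {δ δ' : ℝ} {L : ℝ≥0∞} {f : V → Y} (hf : LipschitzAtDepth Ω δ L f) (h : δ ≤ δ') :
    LipschitzAtDepth Ω δ' L f :=
  fun x y hxy => hf x y (hxy.trans (innerParallelSet_anti h))

lemma ball_subset_innerParallelSet {X : Type*} [PseudoMetricSpace X] {Ω : Set X} {x : X} {δ : ℝ}
    (h : Metric.ball x (2 * δ) ⊆ Ω) : Metric.ball x δ ⊆ innerParallelSet Ω δ := fun y hy =>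
  (Metric.ball_subset_ball' (by linarith [Metric.mem_ball.1 hy])).trans h

lemma exists_ball_subset_innerParallelSet {X : Type*} [PseudoMetricSpace X] {Ω K : Set X}
    (hK : IsCompact K) (hopen : IsOpen Ω) (hKΩ : K ⊆ Ω) :
    ∃ δ > 0, ∀ x ∈ K, Metric.ball x δ ⊆ innerParallelSet Ω δ := by
  obtain ⟨ρ, hρ, hρΩ⟩ := hK.exists_thickening_subset_open hopen hKΩ
  refine ⟨ρ / 2, half_pos hρ, fun x hx => ball_subset_innerParallelSet ?_⟩
  rw [mul_div_cancel₀ ρ two_ne_zero]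
  exact (Metric.ball_subset_thickening hx ρ).trans hρΩ

variable {n : ℕ} {Ω : Set (E n)}

lemma exists_edist_le_of_intrinsicDist_lt (hopen : IsOpen Ω) {p q : E n} {M : ℝ≥0∞}
    (h : intrinsicDist Ω p q < M) :
    ∃ δ > 0, ∀ᶠ w : E n × E n in 𝓝 (p, q), ∀ (f : E n → Y) (L : ℝ≥0∞),
      LipschitzAtDepth Ω δ L f → edist (f w.1) (f w.2) ≤ L * M := by
  obtain ⟨γ, ⟨hγ, hγΩ, rfl, rfl⟩, h_len⟩ : ∃ γ : ℝ → E n, (ContinuousOn γ (Icc 0 1) ∧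
      MapsTo γ (Icc 0 1) Ω ∧ γ 0 = p ∧ γ 1 = q) ∧ eVariationOn γ (Icc 0 1) < M := by
    simpa only [intrinsicDist, iInf_lt_iff, exists_prop] using h
  obtain ⟨δ, hδ, h_ball⟩ := exists_ball_subset_innerParallelSet
    (isCompact_Icc.image_of_continuousOn hγ) hopen hγΩ.image_subset
  have h_near : ∀ s ∈ Icc (0 : ℝ) 1, ∀ y ∈ Metric.ball (γ s) δ, ∀ (f : E n → Y) L,
      LipschitzAtDepth Ω δ L f → edist (f (γ s)) (f y) ≤ L * edist (γ s) y :=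
    fun s hs y hy f L hf => hf _ _ <|
      ((convex_ball _ _).segment_subset (Metric.mem_ball_self hδ) hy).trans
        (h_ball (γ s) (mem_image_of_mem γ hs))
  obtain ⟨τ, hτ, hγτ⟩ := Metric.uniformContinuousOn_iff.1
    (isCompact_Icc.uniformContinuousOn_of_continuous hγ) δ hδ
  have h_close : ∀ᶠ w : E n × E n in 𝓝 (γ 0, γ 1),
      edist (γ 0) w.1 + eVariationOn γ (Icc 0 1) + edist (γ 1) w.2 < M := by
    refine Continuous.tendsto (by fun_prop) (γ 0, γ 1) |>.eventually_lt_const ?_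
    simpa using h_len
  refine ⟨δ, hδ, ?_⟩
  filter_upwards [h_close, prod_mem_nhds (Metric.ball_mem_nhds (γ 0) hδ)
    (Metric.ball_mem_nhds (γ 1) hδ)] with w hw ⟨hw₀, hw₁⟩ f L hf
  have h_curve : edist (f (γ 0)) (f (γ 1)) ≤ L * eVariationOn γ (Icc 0 1) :=
    edist_le_mul_eVariationOn (η := f ∘ γ) hτ fun s hs t ht hst =>
      h_near s hs _ (Metric.mem_ball'.2 (hγτ s hs t ht hst)) f L hf
  calc edist (f w.1) (f w.2)
      ≤ edist (f w.1) (f (γ 0)) + edist (f (γ 0)) (f (γ 1)) + edist (f (γ 1)) (f w.2) :=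
        edist_triangle4 _ _ _ _
    _ ≤ L * edist (γ 0) w.1 + L * eVariationOn γ (Icc 0 1) + L * edist (γ 1) w.2 := by
        rw [edist_comm (f w.1)]
        exact add_le_add_three (h_near 0 (by simp) _ hw₀ f L hf) h_curve
          (h_near 1 (by simp) _ hw₁ f L hf)
    _ ≤ L * M := by
        rw [← mul_add, ← mul_add]
        gcongr

lemma exists_edist_le_on_isCompact (hopen : IsOpen Ω) {K : Set (E n)} (hK : IsCompact K)
    {M : ℝ≥0∞} (hM : ∀ p ∈ K, ∀ q ∈ K, intrinsicDist Ω p q < M) :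
    ∃ δ > 0, ∀ (f : E n → Y) (L : ℝ≥0∞), LipschitzAtDepth Ω δ L f →
      ∀ p ∈ K, ∀ q ∈ K, edist (f p) (f q) ≤ L * M := by
  have h_forall : ∀ᶠ δ in 𝓝 (0 : ℝ), ∀ w ∈ K ×ˢ K, ∀ (f : E n → Y) (L : ℝ≥0∞),
      LipschitzAtDepth Ω δ L f → edist (f w.1) (f w.2) ≤ L * M := by
    refine (hK.prod hK).eventually_forall_of_forall_eventually fun w hw => ?_
    obtain ⟨δ, hδ, h⟩ := exists_edist_le_of_intrinsicDist_lt (Y := Y) hopen (hM _ hw.1 _ hw.2)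
    filter_upwards [prod_mem_nhds (Iio_mem_nhds hδ) h] with z ⟨hzδ, hz⟩ f L hf
    exact hz f L (hf.mono (le_of_lt hzδ))
  obtain ⟨δ, hδK, hδ⟩ :=
    ((h_forall.filter_mono nhdsWithin_le_nhds).and (self_mem_nhdsWithin (s := Ioi 0))).exists
  exact ⟨δ, hδ, fun f L hf p hp q hq => hδK (p, q) (mk_mem_prod hp hq) f L hf⟩

end Oscillation

section Average

variable {α β F : Type*} [MeasurableSpace α] [MeasurableSpace β] [NormedAddCommGroup F]
  {μ : Measure α} {ν : Measure β} {p : ℝ≥0∞}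

lemma eLpNorm_rpow_toReal (hp : p ≠ 0) (hp' : p ≠ ⊤) {ε : Type*} [ENorm ε] (f : α → ε) :
    eLpNorm f p μ ^ p.toReal = ∫⁻ x, ‖f x‖ₑ ^ p.toReal ∂μ := by
  rw [eLpNorm_eq_lintegral_rpow_enorm_toReal hp hp', one_div,
    ENNReal.rpow_inv_rpow (ENNReal.toReal_ne_zero.2 ⟨hp, hp'⟩)]

lemma eLpNorm_eLpNorm_swap [SFinite μ] [SFinite ν] (hp : p ≠ 0) (hp' : p ≠ ⊤) {f : α → β → F}
    (hf : AEStronglyMeasurable (Function.uncurry f) (μ.prod ν)) :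
    eLpNorm (fun x => eLpNorm (f x) p ν) p μ =
      eLpNorm (fun y => eLpNorm (fun x => f x y) p μ) p ν := by
  refine ENNReal.rpow_left_injective (ENNReal.toReal_ne_zero.2 ⟨hp, hp'⟩) ?_
  simp only [eLpNorm_rpow_toReal hp hp', enorm_eq_self]
  exact lintegral_lintegral_swap (hf.enorm.pow_const _)

variable [NormedSpace ℝ F]

lemma enorm_integral_le_eLpNorm [IsProbabilityMeasure ν] (hp : 1 ≤ p) {f : β → F}
    (hf : AEStronglyMeasurable f ν) : ‖∫ y, f y ∂ν‖ₑ ≤ eLpNorm f p ν :=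
  calc ‖∫ y, f y ∂ν‖ₑ ≤ ∫⁻ y, ‖f y‖ₑ ∂ν := enorm_integral_le_lintegral_enorm f
    _ = eLpNorm f 1 ν := eLpNorm_one_eq_lintegral_enorm.symm
    _ ≤ eLpNorm f p ν := eLpNorm_le_eLpNorm_of_exponent_le hp hf

lemma eLpNorm_integral_le [SFinite μ] [IsProbabilityMeasure ν] (hp : 1 ≤ p) (hp' : p ≠ ⊤)
    {f : α → β → F} (hf : AEStronglyMeasurable (Function.uncurry f) (μ.prod ν)) {C : ℝ≥0∞}
    (hC : ∀ᵐ y ∂ν, eLpNorm (fun x => f x y) p μ ≤ C) :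
    eLpNorm (fun x => ∫ y, f x y ∂ν) p μ ≤ C :=
  calc eLpNorm (fun x => ∫ y, f x y ∂ν) p μ
      ≤ eLpNorm (fun x => eLpNorm (f x) p ν) p μ := by
        refine eLpNorm_mono_enorm_ae ?_
        filter_upwards [hf.prodMk_left] with x hx
        exact enorm_integral_le_eLpNorm hp hx
    _ = eLpNorm (fun y => eLpNorm (fun x => f x y) p μ) p ν :=
        eLpNorm_eLpNorm_swap (one_pos.trans_le hp).ne' hp' hf
    _ ≤ eLpNorm (fun _ => C) p ν := eLpNorm_mono_enorm_ae hC
    _ = C := by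
        rw [eLpNorm_const' _ (one_pos.trans_le hp).ne' hp', measure_univ, ENNReal.one_rpow, mul_one,
          enorm_eq_self]

end Average

section Mollify

variable {V F : Type*} [NormedAddCommGroup V] [InnerProductSpace ℝ V] [FiniteDimensional ℝ V]
  [MeasurableSpace V] [BorelSpace V] [NormedAddCommGroup F] [NormedSpace ℝ F]
  (φ : ContDiffBump (0 : V)) {f : V → F} {p : ℝ≥0∞}

/-- The mollification of `f`: its convolution with the normalized bump function `φ`. -/
noncomputable def mollify (f : V → F) : V → F :=
  convolution (φ.normed volume) f (ContinuousLinearMap.lsmul ℝ ℝ) volume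

/-- The probability measure with density the normalized bump function `φ`. -/
noncomputable def bumpMeasure : Measure V :=
  volume.withDensity fun t => ENNReal.ofReal (φ.normed volume t)

lemma measurable_ofReal_normed : Measurable fun t => ENNReal.ofReal (φ.normed volume t) :=
  φ.continuous_normed.measurable.ennreal_ofReal

instance isProbabilityMeasure_bumpMeasure : IsProbabilityMeasure (bumpMeasure φ) := ⟨by
  rw [bumpMeasure, withDensity_apply _ MeasurableSet.univ, Measure.restrict_univ,
    ← ofReal_integral_eq_lintegral_ofReal φ.integrable_normed
      (Eventually.of_forall φ.nonneg_normed), φ.integral_normed, ENNReal.ofReal_one]⟩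

lemma ae_bumpMeasure_norm_lt : ∀ᵐ t ∂(bumpMeasure φ), ‖t‖ < φ.rOut := by
  rw [bumpMeasure, ae_withDensity_iff (measurable_ofReal_normed φ)]
  refine Eventually.of_forall fun t ht => ?_
  have ht : t ∈ Function.support (φ.normed volume) := fun h => ht (by rw [h, ENNReal.ofReal_zero])
  rwa [φ.support_normed_eq, mem_ball_zero_iff] at ht

lemma exists_bumpMeasure_le_smul : ∃ B ≠ (⊤ : ℝ≥0∞), bumpMeasure φ ≤ B • volume := by
  refine ⟨ENNReal.ofReal (1 / (volume : Measure V).real (Metric.closedBall 0 φ.rIn)),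
    ENNReal.ofReal_ne_top, ?_⟩
  rw [← withDensity_const]
  exact withDensity_mono <| Eventually.of_forall fun t =>
    ENNReal.ofReal_le_ofReal (φ.normed_le_div_measure_closedBall_rIn volume t)

lemma mollify_eq_integral_bumpMeasure (f : V → F) (x : V) :
    mollify φ f x = ∫ t, f (x - t) ∂(bumpMeasure φ) := by
  rw [bumpMeasure, integral_withDensity_eq_integral_toReal_smul (measurable_ofReal_normed φ)
    (by simp)]
  simp only [ENNReal.toReal_ofReal (φ.nonneg_normed _)]
  rfl

lemma integrable_normed_sub_smul (hf : LocallyIntegrable f) (x : V) :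
    Integrable fun y => φ.normed volume (x - y) • f y :=
  φ.hasCompactSupport_normed.convolutionExists_right
    (ContinuousLinearMap.lsmul ℝ ℝ : ℝ →L[ℝ] F →L[ℝ] F).flip hf φ.continuous_normed x

lemma integrable_comp_sub_bumpMeasure (hf : LocallyIntegrable f) (x : V) :
    Integrable (fun t => f (x - t)) (bumpMeasure φ) := by
  rw [bumpMeasure, integrable_withDensity_iff_integrable_smul' (measurable_ofReal_normed φ)
    (by simp)]
  simpa only [ENNReal.toReal_ofReal (φ.nonneg_normed _), sub_sub_cancel]
    using (integrable_normed_sub_smul φ hf x).comp_sub_left x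

lemma continuous_mollify (hf : LocallyIntegrable f) : Continuous (mollify φ f) :=
  φ.hasCompactSupport_normed.continuous_convolution_left _ φ.continuous_normed hf

lemma differentiable_mollify (hf : LocallyIntegrable f) : Differentiable ℝ (mollify φ f) :=
  (φ.hasCompactSupport_normed.contDiff_convolution_left _
    (φ.contDiff_normed (n := 1)) hf).differentiable (by simp)

lemma fderiv_mollify_apply {f : V → ℝ} (hf : LocallyIntegrable f) (x e : V) :
    fderiv ℝ (mollify φ f) x e = ∫ y, fderiv ℝ (φ.normed volume) (x - y) e * f y := by
  have h_deriv : fderiv ℝ (mollify φ f) x = _ :=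
    (φ.hasCompactSupport_normed.hasFDerivAt_convolution_left
      (ContinuousLinearMap.lsmul ℝ ℝ : ℝ →L[ℝ] ℝ →L[ℝ] ℝ)
      (φ.contDiff_normed (n := 1)) hf x).fderiv
  rw [h_deriv, convolution_eq_swap, ContinuousLinearMap.integral_apply]
  · rfl
  · exact convolutionExistsAt_iff_integrable_swap.1 <|
      (φ.hasCompactSupport_normed.fderiv ℝ).convolutionExists_left _
        ((φ.contDiff_normed (n := 1)).continuous_fderiv (by simp)) hf x

lemma eLpNorm_mollify_le (hp : 1 ≤ p) (hp' : p ≠ ⊤) (hf : AEStronglyMeasurable f volume) :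
    eLpNorm (mollify φ f) p volume ≤ eLpNorm f p volume := by
  simp only [funext (mollify_eq_integral_bumpMeasure φ f)]
  refine eLpNorm_integral_le hp hp' ?_ (Eventually.of_forall fun t => ?_)
  · exact hf.comp_quasiMeasurePreserving
      (quasiMeasurePreserving_sub_of_right_invariant volume (bumpMeasure φ))
  · exact (eLpNorm_comp_measurePreserving hf (measurePreserving_sub_right volume t)).le

lemma enorm_mollify_le {B : ℝ≥0∞} (hB : bumpMeasure φ ≤ B • volume) (hp : 1 ≤ p) (hp' : p ≠ ⊤)
    (hf : AEStronglyMeasurable f volume) (x : V) :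
    ‖mollify φ f x‖ₑ ≤ B ^ (1 / p).toReal * eLpNorm f p volume := by
  have h_pres := Measure.measurePreserving_sub_left (volume : Measure V) x
  have h_meas : AEStronglyMeasurable (fun t => f (x - t)) volume :=
    hf.comp_measurePreserving h_pres
  have h_ac : bumpMeasure φ ≪ volume := withDensity_absolutelyContinuous _ _
  calc ‖mollify φ f x‖ₑ ≤ eLpNorm (fun t => f (x - t)) p (bumpMeasure φ) := by
        rw [mollify_eq_integral_bumpMeasure]
        exact enorm_integral_le_eLpNorm hp (h_meas.mono_ac h_ac)
    _ ≤ eLpNorm (fun t => f (x - t)) p (B • volume) := eLpNorm_mono_measure _ hB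
    _ = B ^ (1 / p).toReal * eLpNorm f p volume := by
        rw [eLpNorm_smul_measure_of_ne_top hp', smul_eq_mul]
        congr 1
        exact eLpNorm_comp_measurePreserving hf h_pres

end Mollify

section WeakGradient

variable {n : ℕ} {Ω : Set (E n)} {v : E n → ℝ} {G : E n → E n} {p : ℝ≥0∞}

lemma HasWeakGradientOn.integral_eq (h : HasWeakGradientOn Ω v G) {ψ : E n → ℝ}
    (hψ : ContDiff ℝ ∞ ψ) (hψc : HasCompactSupport ψ) (hψΩ : tsupport ψ ⊆ Ω) (e : E n) :
    ∫ x, v x * fderiv ℝ ψ x e = -∫ x, ⟪G x, e⟫ * ψ x := by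
  have h_vanish : ∀ x ∉ Ω, x ∉ tsupport ψ := fun x hx hxψ => hx (hψΩ hxψ)
  have h_eq := h.2.2 ψ hψ hψc hψΩ e
  rwa [setIntegral_eq_integral_of_forall_compl_eq_zero fun x hx => by
      rw [fderiv_of_notMem_tsupport ℝ (h_vanish x hx), zero_apply, mul_zero],
    setIntegral_eq_integral_of_forall_compl_eq_zero fun x hx => by
      rw [image_eq_zero_of_notMem_tsupport (h_vanish x hx), mul_zero]] at h_eq

lemma HasWeakGradientOn.hasGradientAt_mollify (h : HasWeakGradientOn Ω v G)
    (hv : LocallyIntegrable v) (hG : LocallyIntegrable G) (φ : ContDiffBump (0 : E n)) {x : E n}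
    (hx : Metric.closedBall x φ.rOut ⊆ Ω) :
    HasGradientAt (mollify φ v) (mollify φ G x) x := by
  set ψ : E n → ℝ := fun y => φ.normed volume (x - y)
  have hψ_supp : tsupport ψ ⊆ Metric.closedBall x φ.rOut := by
    refine closure_minimal (fun y hy => ?_) Metric.isClosed_closedBall
    have hy : x - y ∈ Function.support (φ.normed volume) := hy
    rw [φ.support_normed_eq, mem_ball_zero_iff] at hy
    exact Metric.mem_closedBall'.2 ((dist_eq_norm x y).trans_le hy.le)
  have hψ_fderiv : ∀ y e, fderiv ℝ ψ y e = -fderiv ℝ (φ.normed volume) (x - y) e := fun y e => by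
    have h_deriv := ((φ.contDiff_normed (μ := volume) (n := 1)).differentiable (by simp)
      (x - y)).hasFDerivAt
    have h_comp : HasFDerivAt ψ _ y := h_deriv.comp y ((hasFDerivAt_id y).const_sub x)
    rw [h_comp.fderiv]
    exact (fderiv ℝ (φ.normed volume) (x - y)).map_neg e
  suffices h_eq : fderiv ℝ (mollify φ v) x = InnerProductSpace.toDual ℝ (E n) (mollify φ G x) from
    hasGradientAt_iff_hasFDerivAt.2 (h_eq ▸ (differentiable_mollify φ hv x).hasFDerivAt)
  refine ContinuousLinearMap.ext fun e => ?_
  calc fderiv ℝ (mollify φ v) x e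
      = ∫ y, fderiv ℝ (φ.normed volume) (x - y) e * v y := fderiv_mollify_apply φ hv x e
    _ = -∫ y, v y * fderiv ℝ ψ y e := by
        rw [← integral_neg]
        simp only [hψ_fderiv, mul_neg, neg_neg, mul_comm]
    _ = ∫ y, ⟪G y, e⟫ * ψ y := by
        rw [h.integral_eq (ψ := ψ) (φ.contDiff_normed.comp (contDiff_const.sub contDiff_id))
          ((isCompact_closedBall x φ.rOut).of_isClosed_subset (isClosed_tsupport ψ) hψ_supp)
          (hψ_supp.trans hx), neg_neg]
    _ = ∫ y, ⟪e, φ.normed volume (x - y) • G y⟫ := by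
        simp only [ψ, inner_smul_right, real_inner_comm, mul_comm]
    _ = ⟪e, ∫ y, φ.normed volume (x - y) • G y⟫ :=
        integral_inner (integrable_normed_sub_smul φ hG x) e
    _ = ⟪mollify φ G x, e⟫ := by
        rw [real_inner_comm, mollify, convolution_lsmul_swap]

lemma HasWeakGradientOn.lipschitzAtDepth_mollify (h : HasWeakGradientOn Ω v G)
    (hv : LocallyIntegrable v) (hG : LocallyIntegrable G) (φ : ContDiffBump (0 : E n)) {δ : ℝ}
    (hδ : φ.rOut < δ) {L : ℝ≥0∞} (hL : ∀ x, ‖mollify φ G x‖ₑ ≤ L) (hL' : L ≠ ⊤) :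
    LipschitzAtDepth Ω δ L (mollify φ v) := fun x y hxy => by
  lift L to NNReal using hL'
  refine (convex_segment x y).lipschitzOnWith_of_nnnorm_hasFDerivWithin_le
    (f' := fun z => InnerProductSpace.toDual ℝ (E n) (mollify φ G z)) (fun z hz => ?_)
    (fun z _ => ?_) (left_mem_segment ℝ x y) (right_mem_segment ℝ x y)
  · exact (h.hasGradientAt_mollify hv hG φ
      ((Metric.closedBall_subset_ball hδ).trans (hxy hz))).hasFDerivAt.hasFDerivWithinAt
  · rw [LinearIsometryEquiv.nnnorm_map]
    exact ENNReal.coe_le_coe.1 (hL z)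

lemma HasWeakGradientOn.integral_inner_mollify (h : HasWeakGradientOn Ω v G)
    (hv : LocallyIntegrable v) (hG : LocallyIntegrable G) (φ : ContDiffBump (0 : E n)) {x w : E n}
    (hx : ∀ s ∈ Icc (0 : ℝ) 1, Metric.closedBall (x + s • w) φ.rOut ⊆ Ω) :
    ∫ s in Ioc (0 : ℝ) 1, ⟪mollify φ G (x + s • w), w⟫ = mollify φ v (x + w) - mollify φ v x := by
  have hG_cont := continuous_mollify φ hG
  have h_deriv : ∀ s ∈ uIcc (0 : ℝ) 1, HasDerivAt (fun s : ℝ => mollify φ v (x + s • w))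
      ⟪mollify φ G (x + s • w), w⟫ s := fun s hs => by
    have h_line : HasDerivAt (fun s : ℝ => x + s • w) w s := by
      simpa using ((hasDerivAt_id s).smul_const w).const_add x
    exact (h.hasGradientAt_mollify hv hG φ
      (hx s (by rwa [uIcc_of_le zero_le_one] at hs))).hasFDerivAt.comp_hasDerivAt s h_line
  have h_cont : Continuous fun s : ℝ => ⟪mollify φ G (x + s • w), w⟫ := by fun_prop
  rw [← intervalIntegral.integral_of_le zero_le_one,
    intervalIntegral.integral_eq_sub_of_hasDerivAt h_deriv (h_cont.intervalIntegrable 0 1)]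
  simp only [one_smul, zero_smul, add_zero]

lemma eLpNorm_integral_inner_translate_le {V : Type*} [NormedAddCommGroup V]
    [InnerProductSpace ℝ V] [FiniteDimensional ℝ V] [MeasurableSpace V] [BorelSpace V]
    {H : V → V} (hH : Continuous H) (w : V) (hp : 1 ≤ p) (hp' : p ≠ ⊤) :
    eLpNorm (fun x => ∫ s in Ioc (0 : ℝ) 1, ⟪H (x + s • w), w⟫) p volume ≤
      ‖w‖ₑ * eLpNorm H p volume := by
  have : IsProbabilityMeasure (volume.restrict (Ioc (0 : ℝ) 1)) := ⟨by simp⟩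
  have h_cont : Continuous fun z : V × ℝ => ⟪H (z.1 + z.2 • w), w⟫ := by fun_prop
  refine eLpNorm_integral_le hp hp' h_cont.aestronglyMeasurable (Eventually.of_forall fun s => ?_)
  calc eLpNorm (fun x => ⟪H (x + s • w), w⟫) p volume
      ≤ ‖w‖ₑ * eLpNorm (fun x => H (x + s • w)) p volume :=
        eLpNorm_le_nnreal_smul_eLpNorm_of_ae_le_mul (Eventually.of_forall fun x =>
          (norm_inner_le_norm _ _).trans_eq (mul_comm _ _)) p
    _ = ‖w‖ₑ * eLpNorm H p volume := by
        rw [← eLpNorm_comp_measurePreserving hH.aestronglyMeasurable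
          (measurePreserving_add_right volume (s • w))]
        rfl

lemma exists_seq_ae_tendsto_mollify {V F : Type*} [NormedAddCommGroup V] [InnerProductSpace ℝ V]
    [FiniteDimensional ℝ V] [MeasurableSpace V] [BorelSpace V] [NormedAddCommGroup F]
    [NormedSpace ℝ F] [CompleteSpace F] {f : V → F} (hf : LocallyIntegrable f) :
    ∃ φ : ℕ → ContDiffBump (0 : V), Tendsto (fun k => (φ k).rOut) atTop (𝓝 0) ∧
      ∀ᵐ x, Tendsto (fun k => mollify (φ k) f x) atTop (𝓝 (f x)) := by
  let φ : ℕ → ContDiffBump (0 : V) := fun k =>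
    ⟨1 / ((k : ℝ) + 1), 2 * (1 / ((k : ℝ) + 1)), by positivity, lt_two_mul_self (by positivity)⟩
  have h_rOut : Tendsto (fun k => (φ k).rOut) atTop (𝓝 0) := by
    simpa only [mul_zero] using (tendsto_one_div_add_atTop_nhds_zero_nat (𝕜 := ℝ)).const_mul 2
  exact ⟨φ, h_rOut, ContDiffBump.ae_convolution_tendsto_right_of_locallyIntegrable (K := 2) h_rOut
    (Eventually.of_forall fun k => le_rfl) hf⟩

lemma HasWeakGradientOn.tendsto_integral_inner_mollify (h : HasWeakGradientOn Ω v G)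
    (hopen : IsOpen Ω) (hv : LocallyIntegrable v) (hG : LocallyIntegrable G)
    {φ : ℕ → ContDiffBump (0 : E n)} (hφ : Tendsto (fun k => (φ k).rOut) atTop (𝓝 0)) {x w : E n}
    (hxw : segment ℝ x (x + w) ⊆ Ω)
    (hx : Tendsto (fun k => mollify (φ k) v x) atTop (𝓝 (v x)))
    (hx' : Tendsto (fun k => mollify (φ k) v (x + w)) atTop (𝓝 (v (x + w)))) :
    Tendsto (fun k => ∫ s in Ioc (0 : ℝ) 1, ⟪mollify (φ k) G (x + s • w), w⟫) atTop
      (𝓝 (v (x + w) - v x)) := by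
  rw [segment_eq_image', add_sub_cancel_left] at hxw
  have h_compact : IsCompact ((fun s : ℝ => x + s • w) '' Icc 0 1) :=
    isCompact_Icc.image (by fun_prop)
  obtain ⟨ρ, hρ, hρΩ⟩ := h_compact.exists_thickening_subset_open hopen hxw
  have h_eq : ∀ᶠ k in atTop, mollify (φ k) v (x + w) - mollify (φ k) v x =
      ∫ s in Ioc (0 : ℝ) 1, ⟪mollify (φ k) G (x + s • w), w⟫ := by
    filter_upwards [hφ.eventually_lt_const hρ] with k hk
    refine (h.integral_inner_mollify hv hG (φ k) fun s hs => ?_).symm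
    have h_mem := mem_image_of_mem (fun s : ℝ => x + s • w) hs
    exact (Metric.closedBall_subset_ball hk).trans
      ((Metric.ball_subset_thickening h_mem ρ).trans hρΩ)
  exact (hx'.sub hx).congr' h_eq

lemma HasWeakGradientOn.eLpNorm_translate_sub_le (h : HasWeakGradientOn Ω v G) (hopen : IsOpen Ω)
    (hv : LocallyIntegrable v) (hG : LocallyIntegrable G) (hp : 1 ≤ p) (hp' : p ≠ ⊤)
    {A : Set (E n)} (hA : MeasurableSet A) {w : E n} (hAw : ∀ x ∈ A, segment ℝ x (x + w) ⊆ Ω) :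
    eLpNorm (fun x => v (x + w) - v x) p (volume.restrict A) ≤ ‖w‖ₑ * eLpNorm G p volume := by
  obtain ⟨φ, hφ, h_conv⟩ := exists_seq_ae_tendsto_mollify hv
  have h_conv' := (measurePreserving_add_right volume w).quasiMeasurePreserving.ae h_conv
  set f : ℕ → E n → ℝ := fun k x => ∫ s in Ioc (0 : ℝ) 1, ⟪mollify (φ k) G (x + s • w), w⟫
  have hG_cont : ∀ k, Continuous (mollify (φ k) G) := fun k => continuous_mollify _ hG
  have hf_meas : ∀ k, StronglyMeasurable (f k) := fun k => by
    have h_cont : Continuous fun z : E n × ℝ => ⟪mollify (φ k) G (z.1 + z.2 • w), w⟫ := by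
      have := hG_cont k
      fun_prop
    exact h_cont.stronglyMeasurable.integral_prod_right'
  have hf_lim : ∀ᵐ x ∂volume.restrict A, Tendsto (fun k => f k x) atTop (𝓝 (v (x + w) - v x)) := by
    filter_upwards [ae_restrict_of_ae h_conv, ae_restrict_of_ae h_conv', ae_restrict_mem hA]
      with x hx hx' hxA
    exact h.tendsto_integral_inner_mollify hopen hv hG hφ (hAw x hxA) hx hx'
  refine Lp.eLpNorm_le_of_ae_tendsto (Eventually.of_forall fun k => ?_)
    (fun k => (hf_meas k).aestronglyMeasurable) hf_lim
  calc eLpNorm (f k) p (volume.restrict A)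
      ≤ eLpNorm (f k) p volume := eLpNorm_mono_measure _ Measure.restrict_le_self
    _ ≤ ‖w‖ₑ * eLpNorm (mollify (φ k) G) p volume :=
        eLpNorm_integral_inner_translate_le (hG_cont k) w hp hp'
    _ ≤ ‖w‖ₑ * eLpNorm G p volume := by
        gcongr
        exact eLpNorm_mollify_le _ hp hp' hG.aestronglyMeasurable

lemma HasWeakGradientOn.eLpNorm_mollify_sub_le_on_coneSet (h : HasWeakGradientOn Ω v G)
    (hopen : IsOpen Ω) (hv : LocallyIntegrable v) (hG : LocallyIntegrable G) (hp : 1 ≤ p)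
    (hp' : p ≠ ⊤) {c : ℝ} (hc : 0 < c) (ν : E n) {φ : ContDiffBump (0 : E n)}
    (hφ : φ.rOut ≤ c * c) :
    eLpNorm (fun x => mollify φ v (x + c • ν) - v x) p (volume.restrict (coneSet Ω c ν)) ≤
      ENNReal.ofReal (c * (‖ν‖ + c)) * eLpNorm G p volume := by
  have h_eq : ∀ x, mollify φ v (x + c • ν) - v x =
      ∫ u, (v (x + c • ν - u) - v x) ∂bumpMeasure φ := fun x => by
    rw [integral_sub (integrable_comp_sub_bumpMeasure φ hv _) (integrable_const _),
      integral_const, probReal_univ, one_smul, ← mollify_eq_integral_bumpMeasure]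
  simp only [h_eq]
  refine eLpNorm_integral_le hp hp' ?_ ?_
  · have h_sub := quasiMeasurePreserving_sub_of_right_invariant (volume : Measure (E n))
      (bumpMeasure φ)
    have h_ac : (volume.restrict (coneSet Ω c ν)).prod (bumpMeasure φ) ≪
        (volume : Measure (E n)).prod (bumpMeasure φ) :=
      Measure.restrict_le_self.absolutelyContinuous.prod .rfl
    refine AEStronglyMeasurable.mono_ac h_ac (AEStronglyMeasurable.sub ?_ ?_)
    · simp only [add_sub_right_comm]
      exact hv.aestronglyMeasurable.comp_quasiMeasurePreserving
        ((measurePreserving_add_right volume (c • ν)).quasiMeasurePreserving.comp h_sub)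
    · exact hv.aestronglyMeasurable.comp_fst
  · filter_upwards [ae_bumpMeasure_norm_lt φ] with u hu
    have hw : ν - c⁻¹ • u ∈ Metric.closedBall ν c := by
      rw [mem_closedBall_iff_norm, sub_sub_cancel_left, norm_neg, norm_smul, norm_inv,
        Real.norm_of_nonneg hc.le, inv_mul_le_iff₀ hc]
      exact hu.le.trans hφ
    have h_vec : c • ν - u = c • (ν - c⁻¹ • u) := by
      rw [smul_sub, smul_inv_smul₀ hc.ne']
    simp only [add_sub_assoc, h_vec]
    refine (h.eLpNorm_translate_sub_le hopen hv hG hp hp' (isOpen_coneSet hopen).measurableSet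
      fun x hx => segment_subset_of_mem_coneSet hc.le hx hw).trans ?_
    gcongr
    rw [← ofReal_norm]
    exact ENNReal.ofReal_le_ofReal (norm_smul_le_of_mem_closedBall ⟨hc.le, le_rfl⟩ hw)

lemma HasWeakGradientOn.congr {v' : E n → ℝ} {G' : E n → E n} (h : HasWeakGradientOn Ω v G)
    (hΩ : MeasurableSet Ω) (hv : EqOn v v' Ω) (hG : EqOn G G' Ω) : HasWeakGradientOn Ω v' G' := by
  refine ⟨h.1.congr (ae_restrict_of_forall_mem hΩ hv),
    h.2.1.congr (ae_restrict_of_forall_mem hΩ hG), fun ψ hψ hψc hψΩ e => ?_⟩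
  have h_eq := h.2.2 ψ hψ hψc hψΩ e
  have hv_int : ∫ x in Ω, v x * fderiv ℝ ψ x e = ∫ x in Ω, v' x * fderiv ℝ ψ x e :=
    setIntegral_congr_fun hΩ fun x hx => by rw [hv hx]
  have hG_int : ∫ x in Ω, ⟪G x, e⟫ * ψ x = ∫ x in Ω, ⟪G' x, e⟫ * ψ x :=
    setIntegral_congr_fun hΩ fun x hx => by rw [hG hx]
  rwa [hv_int, hG_int] at h_eq

lemma locallyIntegrable_indicator_of_memLp {α F : Type*} [TopologicalSpace α] [MeasurableSpace α]
    [NormedAddCommGroup F] {μ : Measure α} {s : Set α} {f : α → F} (hs : MeasurableSet s)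
    (hμs : μ s ≠ ⊤) (hp : 1 ≤ p) (hf : MemLp f p (μ.restrict s)) :
    LocallyIntegrable (s.indicator f) μ := by
  have : IsFiniteMeasure (μ.restrict s) := ⟨by rwa [Measure.restrict_apply_univ, lt_top_iff_ne_top]⟩
  exact (IntegrableOn.integrable_indicator (hf.integrable hp) hs).locallyIntegrable

end WeakGradient

section Poincare

lemma exists_edist_le_ediam_div_two (s : Set ℝ) :
    ∃ a, ∀ x ∈ s, edist x a ≤ Metric.ediam s / 2 := by
  by_cases hs : Metric.ediam s = ⊤
  · exact ⟨0, fun x _ => by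
      rw [hs, ENNReal.top_div_of_ne_top ENNReal.ofNat_ne_top]
      exact le_top⟩
  have hs_bdd : Bornology.IsBounded s := Metric.isBounded_iff_ediam_ne_top.2 hs
  refine ⟨(sInf s + sSup s) / 2, fun x hx => ?_⟩
  have hx_Inf := csInf_le hs_bdd.bddBelow hx
  have hx_Sup := le_csSup hs_bdd.bddAbove hx
  rw [Real.ediam_eq hs_bdd, edist_dist, Real.dist_eq, ← ENNReal.ofReal_ofNat,
    ← ENNReal.ofReal_div_of_pos two_pos]
  exact ENNReal.ofReal_le_ofReal (abs_le.2 ⟨by linarith, by linarith⟩)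

lemma eventually_rpow_one_div_le {b y : ℝ≥0∞} (hb : b ≠ ⊤) (hy : 1 < y) :
    ∀ᶠ p : ℝ in atTop, b ^ (1 / p) ≤ y := by
  filter_upwards [(ENNReal.tendsto_rpow_atTop_of_one_lt_base hy).eventually_const_lt hb.lt_top,
    eventually_gt_atTop 0] with p hbp hp
  rw [one_div, ENNReal.rpow_inv_le_iff hp]
  exact hbp.le

lemma eLpNorm_restrict_le_add_sum {α ι F F' : Type*} [MeasurableSpace α] [NormedAddCommGroup F]
    [NormedAddCommGroup F'] {μ : Measure α} {p : ℝ≥0∞} (hp : 1 ≤ p) (hp' : p ≠ ⊤) {s : Set α}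
    (hs : MeasurableSet s) {S : Finset ι} {A : ι → Set α} (hA : ∀ i ∈ S, MeasurableSet (A i))
    (hsA : s ⊆ ⋃ i ∈ S, A i) {g : α → F} {f : ι → α → F'}
    (hf : ∀ i ∈ S, AEStronglyMeasurable (f i) μ) {K : ℝ≥0∞}
    (h : ∀ i ∈ S, ∀ x ∈ A i, ‖g x‖ₑ ≤ K + ‖f i x‖ₑ) :
    eLpNorm g p (μ.restrict s) ≤
      K * μ s ^ (1 / p.toReal) + ∑ i ∈ S, eLpNorm (f i) p (μ.restrict (A i)) := by
  set F : ι → α → ℝ≥0∞ := fun i x => ‖(A i).indicator (f i) x‖ₑ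
  have hF : ∀ i ∈ S, AEStronglyMeasurable (F i) (μ.restrict s) := fun i hi =>
    ((hf i hi).restrict.indicator (hA i hi)).enorm.aestronglyMeasurable
  have h_pointwise : ∀ x ∈ s, ‖g x‖ₑ ≤ K + ∑ i ∈ S, F i x := fun x hx => by
    obtain ⟨i, hi, hxi⟩ := mem_iUnion₂.1 (hsA hx)
    calc ‖g x‖ₑ ≤ K + F i x := by
          simpa only [F, indicator_of_mem hxi] using h i hi x hxi
      _ ≤ K + ∑ i ∈ S, F i x := by
          gcongr
          exact Finset.single_le_sum (f := fun i => F i x) (fun _ _ => zero_le) hi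
  calc eLpNorm g p (μ.restrict s)
      ≤ eLpNorm ((fun _ => K) + ∑ i ∈ S, F i) p (μ.restrict s) :=
        eLpNorm_mono_enorm_ae <| ae_restrict_of_forall_mem hs fun x hx => by
          simpa only [Pi.add_apply, Finset.sum_apply, enorm_eq_self] using h_pointwise x hx
    _ ≤ eLpNorm (fun _ => K) p (μ.restrict s) + ∑ i ∈ S, eLpNorm (F i) p (μ.restrict s) :=
        (eLpNorm_add_le aestronglyMeasurable_const
          (Finset.aestronglyMeasurable_sum S hF) hp).trans (by gcongr; exact eLpNorm_sum_le hF hp)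
    _ ≤ K * μ s ^ (1 / p.toReal) + ∑ i ∈ S, eLpNorm (f i) p (μ.restrict (A i)) := by
        gcongr with i hi
        · rw [eLpNorm_const' K (one_pos.trans_le hp).ne' hp', enorm_eq_self,
            Measure.restrict_apply_univ]
        · rw [eLpNorm_enorm, ← eLpNorm_indicator_eq_eLpNorm_restrict (hA i hi)]
          exact eLpNorm_mono_measure _ Measure.restrict_le_self

variable {n : ℕ} {Ω : Set (E n)} {v : E n → ℝ} {G : E n → E n} {p : ℝ≥0∞}

lemma HasWeakGradientOn.exists_eLpNorm_sub_const_le (h : HasWeakGradientOn Ω v G)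
    (hopen : IsOpen Ω) (hv : LocallyIntegrable v) (hG : LocallyIntegrable G) (hp : 1 ≤ p)
    (hp' : p ≠ ⊤) {c : ℝ} (hc : 0 < c) {S : Finset (E n)} (hS : Ω ⊆ ⋃ ν ∈ S, coneSet Ω c ν)
    {φ : ContDiffBump (0 : E n)} (hφ : φ.rOut ≤ c * c) {D : ℝ≥0∞}
    (hD : ∀ x ∈ innerParallelSet Ω (c * c), ∀ y ∈ innerParallelSet Ω (c * c),
      edist (mollify φ v x) (mollify φ v y) ≤ D) :
    ∃ a : ℝ, eLpNorm (fun x => v x - a) p (volume.restrict Ω) ≤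
      D / 2 * volume Ω ^ (1 / p.toReal) +
        (∑ ν ∈ S, ENNReal.ofReal (c * (‖ν‖ + c))) * eLpNorm G p volume := by
  obtain ⟨a, ha⟩ := exists_edist_le_ediam_div_two (mollify φ v '' innerParallelSet Ω (c * c))
  set f : E n → E n → ℝ := fun ν x => mollify φ v (x + c • ν) - v x
  have h_cone : ∀ ν ∈ S, ∀ x ∈ coneSet Ω c ν, ‖v x - a‖ₑ ≤ D / 2 + ‖f ν x‖ₑ := fun ν _ x hx =>
    calc ‖v x - a‖ₑ = ‖(mollify φ v (x + c • ν) - a) - f ν x‖ₑ := by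
          simp only [f, sub_sub_sub_cancel_left]
      _ ≤ ‖mollify φ v (x + c • ν) - a‖ₑ + ‖f ν x‖ₑ := enorm_sub_le
      _ ≤ D / 2 + ‖f ν x‖ₑ := by
          rw [← edist_eq_enorm_sub]
          gcongr
          exact (ha _ (mem_image_of_mem _ (add_smul_mem_innerParallelSet hc hx))).trans
            (ENNReal.div_le_div_right (Metric.ediam_image_le_iff.2 hD) 2)
  have hf : ∀ ν ∈ S, AEStronglyMeasurable (f ν) volume := fun ν _ =>
    ((continuous_mollify φ hv).comp (continuous_add_const _)).aestronglyMeasurable.sub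
      hv.aestronglyMeasurable
  refine ⟨a, (eLpNorm_restrict_le_add_sum hp hp' hopen.measurableSet
    (fun ν _ => (isOpen_coneSet hopen).measurableSet) hS hf h_cone).trans ?_⟩
  rw [Finset.sum_mul]
  gcongr with ν
  exact h.eLpNorm_mollify_sub_le_on_coneSet hopen hv hG hp hp' hc ν hφ

lemma UniformConeCondition.exists_sum_le {V : Type*} [NormedAddCommGroup V] [NormedSpace ℝ V]
    {Ω : Set V} (hcone : UniformConeCondition Ω) {ε : ℝ≥0∞} (hε : 0 < ε) :
    ∃ c > 0, ∃ S : Finset V, Ω ⊆ ⋃ ν ∈ S, coneSet Ω c ν ∧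
      ∑ ν ∈ S, ENNReal.ofReal (c * (‖ν‖ + c)) ≤ ε := by
  obtain ⟨c₀, hc₀, S, hS⟩ := hcone
  have h_lim : Tendsto (fun c : ℝ => ∑ ν ∈ S, ENNReal.ofReal (c * (‖ν‖ + c))) (𝓝[>] 0) (𝓝 0) := by
    have h_cont : Continuous fun c : ℝ => ∑ ν ∈ S, ENNReal.ofReal (c * (‖ν‖ + c)) :=
      continuous_finsetSum S fun ν _ => ENNReal.continuous_ofReal.comp (by fun_prop)
    simpa using (h_cont.tendsto 0).mono_left nhdsWithin_le_nhds
  obtain ⟨c, h_sum, hc, hcc₀⟩ :=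
    ((h_lim.eventually_lt_const hε).and (Ioc_mem_nhdsGT hc₀)).exists
  exact ⟨c, hc, S, hS.trans (iUnion₂_mono fun ν _ => coneSet_anti hcc₀), h_sum.le⟩

lemma exists_bump_edist_mollify_le (hopen : IsOpen Ω) (hbdd : Bornology.IsBounded Ω) {M : ℝ≥0∞}
    (hM : intrinsicDiam Ω < M) {ε : ℝ} (hε : 0 < ε) :
    ∃ φ : ContDiffBump (0 : E n), φ.rOut ≤ ε ∧ ∃ B ≠ (⊤ : ℝ≥0∞), ∀ (p : ℝ≥0∞) v G, 1 ≤ p → p ≠ ⊤ →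
      HasWeakGradientOn Ω v G → LocallyIntegrable v → LocallyIntegrable G →
      eLpNorm G p volume ≠ ⊤ → ∀ x ∈ innerParallelSet Ω ε, ∀ y ∈ innerParallelSet Ω ε,
        edist (mollify φ v x) (mollify φ v y) ≤ B ^ (1 / p).toReal * eLpNorm G p volume * M := by
  obtain ⟨δ, hδ, h_osc⟩ := exists_edist_le_on_isCompact (Y := ℝ) hopen
    (isCompact_innerParallelSet hbdd hε) (fun x hx y hy => (intrinsicDist_le_intrinsicDiam
      (innerParallelSet_subset hε hx) (innerParallelSet_subset hε hy)).trans_lt hM)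
  have h_min : 0 < min ε δ := lt_min hε hδ
  let φ : ContDiffBump (0 : E n) := ⟨min ε δ / 4, min ε δ / 2, by linarith, by linarith⟩
  obtain ⟨B, hB, hφB⟩ := exists_bumpMeasure_le_smul φ
  refine ⟨φ, (half_le_self h_min.le).trans (min_le_left _ _), B, hB,
    fun p v G hp hp' hw hv hG hGp => h_osc _ _ ?_⟩
  exact hw.lipschitzAtDepth_mollify hv hG φ ((half_lt_self h_min).trans_le (min_le_right _ _))
    (enorm_mollify_le φ hφB hp hp' hG.aestronglyMeasurable)
    (ENNReal.mul_ne_top (ENNReal.rpow_ne_top_of_nonneg ENNReal.toReal_nonneg hB) hGp)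

lemma eventually_exists_eLpNorm_sub_const_le_of_locallyIntegrable (hopen : IsOpen Ω)
    (hbdd : Bornology.IsBounded Ω) (hcone : UniformConeCondition Ω) {C : ℝ≥0∞}
    (hC : intrinsicDiam Ω / 2 < C) :
    ∀ᶠ p : ℝ in atTop, ∀ v G, HasWeakGradientOn Ω v G → LocallyIntegrable v →
      LocallyIntegrable G → eLpNorm G (ENNReal.ofReal p) volume ≠ ⊤ →
        ∃ a : ℝ, eLpNorm (fun x => v x - a) (ENNReal.ofReal p) (volume.restrict Ω) ≤
          C * eLpNorm G (ENNReal.ofReal p) volume := by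
  obtain ⟨C₁, hC₁, hC₁C⟩ := exists_between hC
  obtain ⟨C₂, hC₁₂, hC₂C⟩ := exists_between hC₁C
  obtain ⟨c, hc, S, hS, h_sum⟩ := hcone.exists_sum_le (tsub_pos_of_lt hC₂C)
  obtain ⟨φ, hφ, B, hB, h_edist⟩ := exists_bump_edist_mollify_le hopen hbdd
    ((ENNReal.div_lt_iff (Or.inl two_ne_zero) (Or.inl ENNReal.ofNat_ne_top)).1 hC₁) (mul_pos hc hc)
  have h_ratio : 1 < C₂ / C₁ := by
    rwa [ENNReal.lt_div_iff_mul_lt (Or.inl (pos_of_gt hC₁).ne') (Or.inl hC₁C.ne_top), one_mul]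
  have h_vol : volume Ω ≠ ⊤ := hbdd.measure_lt_top.ne
  filter_upwards [eventually_rpow_one_div_le (ENNReal.mul_ne_top hB h_vol) h_ratio,
    eventually_ge_atTop 1] with p hBp hp v G hw hv hG hGp
  have hp₀ : 0 ≤ p := zero_le_one.trans hp
  have hp₁ : 1 ≤ ENNReal.ofReal p := ENNReal.one_le_ofReal.2 hp
  obtain ⟨a, ha⟩ := hw.exists_eLpNorm_sub_const_le hopen hv hG hp₁ ENNReal.ofReal_ne_top hc hS hφ
    (h_edist _ v G hp₁ ENNReal.ofReal_ne_top hw hv hG hGp)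
  set N := eLpNorm G (ENNReal.ofReal p) volume
  refine ⟨a, ha.trans ?_⟩
  rw [ENNReal.toReal_div, ENNReal.toReal_one, ENNReal.toReal_ofReal hp₀]
  calc B ^ (1 / p) * N * (C₁ * 2) / 2 * volume Ω ^ (1 / p)
        + (∑ ν ∈ S, ENNReal.ofReal (c * (‖ν‖ + c))) * N
      = C₁ * (B * volume Ω) ^ (1 / p) * N + (∑ ν ∈ S, ENNReal.ofReal (c * (‖ν‖ + c))) * N := by
        rw [ENNReal.mul_rpow_of_nonneg _ _ (one_div_nonneg.2 hp₀), ← mul_assoc,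
          ENNReal.mul_div_cancel_right two_ne_zero ENNReal.ofNat_ne_top]
        ring
    _ ≤ C₁ * (C₂ / C₁) * N + (C - C₂) * N := by gcongr
    _ ≤ C₂ * N + (C - C₂) * N := by gcongr; exact ENNReal.mul_div_le
    _ = C * N := by rw [← add_mul, add_tsub_cancel_of_le hC₂C.le]

lemma eventually_exists_eLpNorm_sub_const_le (hopen : IsOpen Ω) (hbdd : Bornology.IsBounded Ω)
    (hcone : UniformConeCondition Ω) {C : ℝ≥0∞} (hC : intrinsicDiam Ω / 2 < C) :
    ∀ᶠ p : ℝ in atTop, ∀ v G, MemW1p Ω p v G →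
      ∃ a : ℝ, eLpNorm (fun x => v x - a) (ENNReal.ofReal p) (volume.restrict Ω) ≤
        C * eLpNorm G (ENNReal.ofReal p) (volume.restrict Ω) := by
  filter_upwards [eventually_exists_eLpNorm_sub_const_le_of_locallyIntegrable hopen hbdd hcone hC,
    eventually_ge_atTop 1] with p h_poincare hp v G ⟨hv, hG, hw⟩
  have hΩ := hopen.measurableSet
  have hp₁ : 1 ≤ ENNReal.ofReal p := ENNReal.one_le_ofReal.2 hp
  have h_indicator := eLpNorm_indicator_eq_eLpNorm_restrict (μ := volume) (f := G)
    (p := ENNReal.ofReal p) hΩ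
  obtain ⟨a, ha⟩ := h_poincare (Ω.indicator v) (Ω.indicator G)
    (hw.congr hΩ (eqOn_indicator.symm) (eqOn_indicator.symm))
    (locallyIntegrable_indicator_of_memLp hΩ hbdd.measure_lt_top.ne hp₁ hv)
    (locallyIntegrable_indicator_of_memLp hΩ hbdd.measure_lt_top.ne hp₁ hG)
    (h_indicator.trans_ne hG.2.ne)
  refine ⟨a, (eLpNorm_congr_ae ?_).trans_le (ha.trans_eq (by rw [h_indicator]))⟩
  exact ae_restrict_of_forall_mem hΩ fun x hx => by simp only [indicator_of_mem hx]

end Poincare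

section Orthogonality

lemma abs_rpow_sub_mul_le {p : ℝ} (hp : 1 ≤ p) (x a : ℝ) :
    |x| ^ p - p * a * (|x| ^ (p - 2) * x) ≤ |x - a| ^ p := by
  have hp₀ : 0 < p := one_pos.trans_le hp
  rcases eq_or_ne x 0 with rfl | hx
  · rw [abs_zero, mul_zero, mul_zero, sub_zero, Real.zero_rpow hp₀.ne']
    positivity
  have h_bernoulli : 1 - p * (a / x) ≤ |1 - a / x| ^ p := by
    rcases le_or_gt (a / x) 1 with h | h
    · rw [abs_of_nonneg (sub_nonneg.2 h)]
      simpa only [mul_neg, ← sub_eq_add_neg] using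
        one_add_mul_self_le_rpow_one_add (s := -(a / x)) (neg_le_neg h) hp
    · have h_nonneg : 0 ≤ |1 - a / x| ^ p := by positivity
      nlinarith
  have h_split : |x| ^ p = |x| ^ (p - 2) * (x * x) := by
    rw [← abs_mul_abs_self x, ← sq, ← Real.rpow_natCast, ← Real.rpow_add (abs_pos.2 hx),
      Nat.cast_ofNat, sub_add_cancel]
  calc |x| ^ p - p * a * (|x| ^ (p - 2) * x)
      = |x| ^ p * (1 - p * (a / x)) := by rw [h_split]; field_simp
    _ ≤ |x| ^ p * |1 - a / x| ^ p := by gcongr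
    _ = |x - a| ^ p := by
      rw [← Real.mul_rpow (abs_nonneg _) (abs_nonneg _), ← abs_mul, mul_one_sub,
        mul_div_cancel₀ _ hx]

lemma abs_abs_rpow_sub_two_mul {p : ℝ} (hp : p ≠ 1) (x : ℝ) :
    |(|x| ^ (p - 2) * x)| = |x| ^ (p - 1) := by
  rcases eq_or_ne x 0 with rfl | hx
  · rw [mul_zero, abs_zero, Real.zero_rpow (sub_ne_zero.2 hp)]
  · rw [abs_mul, abs_of_nonneg (by positivity), ← Real.rpow_add_one (abs_pos.2 hx).ne']
    ring_nf

variable {α F F' : Type*} [MeasurableSpace α] [NormedAddCommGroup F] [NormedAddCommGroup F']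
  {μ : Measure α} {p : ℝ}

lemma integrable_norm_rpow_of_memLp (hp : 0 < p) {f : α → F} (hf : MemLp f (ENNReal.ofReal p) μ) :
    Integrable (fun x => ‖f x‖ ^ p) μ := by
  simpa only [ENNReal.toReal_ofReal hp.le] using
    hf.integrable_norm_rpow (ENNReal.ofReal_pos.2 hp).ne' ENNReal.ofReal_ne_top

lemma integrable_abs_rpow_sub_two_mul [IsFiniteMeasure μ] (hp : 1 < p) {v : α → ℝ}
    (hv : MemLp v (ENNReal.ofReal p) μ) : Integrable (fun x => |v x| ^ (p - 2) * v x) μ := by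
  have h_memLp : MemLp v (ENNReal.ofReal (p - 1)) μ :=
    hv.mono_exponent (ENNReal.ofReal_le_ofReal (sub_le_self p zero_le_one))
  have h_meas : Measurable fun t : ℝ => |t| ^ (p - 2) * t := by fun_prop
  exact (integrable_norm_rpow_of_memLp (sub_pos.2 hp) h_memLp).mono'
    (h_meas.comp_aemeasurable hv.aestronglyMeasurable.aemeasurable).aestronglyMeasurable
    (.of_forall fun x => (abs_abs_rpow_sub_two_mul hp.ne' (v x)).le)

lemma integral_abs_rpow_le_of_integral_eq_zero [IsFiniteMeasure μ] (hp : 1 < p) {v : α → ℝ}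
    (hv : MemLp v (ENNReal.ofReal p) μ) (h : ∫ x, |v x| ^ (p - 2) * v x ∂μ = 0) (a : ℝ) :
    ∫ x, |v x| ^ p ∂μ ≤ ∫ x, |v x - a| ^ p ∂μ := by
  have hp₀ : 0 < p := one_pos.trans hp
  have hv_int : Integrable (fun x => |v x| ^ p) μ := integrable_norm_rpow_of_memLp hp₀ hv
  have h_mul_int := (integrable_abs_rpow_sub_two_mul hp hv).const_mul (p * a)
  calc ∫ x, |v x| ^ p ∂μ = ∫ x, (|v x| ^ p - p * a * (|v x| ^ (p - 2) * v x)) ∂μ := by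
        rw [integral_sub hv_int h_mul_int, integral_const_mul, h, mul_zero, sub_zero]
    _ ≤ ∫ x, |v x - a| ^ p ∂μ :=
        integral_mono (hv_int.sub h_mul_int)
          (integrable_norm_rpow_of_memLp hp₀ (hv.sub (memLp_const a)))
          fun x => abs_rpow_sub_mul_le hp.le (v x) a

lemma eLpNorm_ofReal_eq_integral (hp : 0 < p) {f : α → F} (hf : MemLp f (ENNReal.ofReal p) μ) :
    eLpNorm f (ENNReal.ofReal p) μ = ENNReal.ofReal ((∫ x, ‖f x‖ ^ p ∂μ) ^ p⁻¹) := by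
  simpa only [ENNReal.toReal_ofReal hp.le] using
    hf.eLpNorm_eq_integral_rpow_norm (ENNReal.ofReal_pos.2 hp).ne' ENNReal.ofReal_ne_top

lemma integral_norm_rpow_le_of_eLpNorm_le (hp : 0 < p) {C : ℝ} (hC : 0 ≤ C) {f : α → F}
    {g : α → F'} (hf : MemLp f (ENNReal.ofReal p) μ) (hg : MemLp g (ENNReal.ofReal p) μ)
    (h : eLpNorm f (ENNReal.ofReal p) μ ≤ ENNReal.ofReal C * eLpNorm g (ENNReal.ofReal p) μ) :
    ∫ x, ‖f x‖ ^ p ∂μ ≤ C ^ p * ∫ x, ‖g x‖ ^ p ∂μ := by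
  have hf₀ : 0 ≤ ∫ x, ‖f x‖ ^ p ∂μ := by positivity
  have hg₀ : 0 ≤ ∫ x, ‖g x‖ ^ p ∂μ := by positivity
  rw [eLpNorm_ofReal_eq_integral hp hf, eLpNorm_ofReal_eq_integral hp hg, ← ENNReal.ofReal_mul hC,
    ENNReal.ofReal_le_ofReal_iff (by positivity),
    Real.rpow_inv_le_iff_of_pos hf₀ (by positivity) hp, Real.mul_rpow hC (by positivity),
    Real.rpow_inv_rpow hg₀ hp.ne'] at h
  exact h

lemma integral_norm_rpow_pos (hp : 0 < p) {f : α → F} (hf : MemLp f (ENNReal.ofReal p) μ)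
    (hf₀ : ¬ f =ᵐ[μ] 0) : 0 < ∫ x, ‖f x‖ ^ p ∂μ := by
  refine (show 0 ≤ ∫ x, ‖f x‖ ^ p ∂μ by positivity).lt_of_ne' fun h => hf₀ ?_
  rw [← eLpNorm_eq_zero_iff hf.aestronglyMeasurable (ENNReal.ofReal_pos.2 hp).ne',
    eLpNorm_ofReal_eq_integral hp hf, h, Real.zero_rpow (inv_ne_zero hp.ne'), ENNReal.ofReal_zero]

end Orthogonality

section LowerBound

variable {n : ℕ} {Ω : Set (E n)}

lemma inv_rpow_le_of_mem_rayleighValues (hΩ : volume Ω ≠ ⊤) {p C : ℝ} (hp : 1 < p) (hC : 0 < C)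
    (h : ∀ v G, MemW1p Ω p v G →
      ∃ a : ℝ, eLpNorm (fun x => v x - a) (ENNReal.ofReal p) (volume.restrict Ω) ≤
        ENNReal.ofReal C * eLpNorm G (ENNReal.ofReal p) (volume.restrict Ω)) :
    ∀ r ∈ rayleighValues Ω p, C⁻¹ ^ p ≤ r := by
  rintro _ ⟨v, G, hvG, hv₀, h_orth, rfl⟩
  have : IsFiniteMeasure (volume.restrict Ω) := isFiniteMeasure_restrict.2 hΩ
  have hp₀ : 0 < p := one_pos.trans hp
  obtain ⟨a, ha⟩ := h v G hvG
  have h_pos : 0 < ∫ x in Ω, |v x| ^ p := integral_norm_rpow_pos hp₀ hvG.1 hv₀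
  rw [le_div_iff₀ h_pos, Real.inv_rpow hC.le,
    inv_mul_le_iff₀ (by positivity)]
  exact (integral_abs_rpow_le_of_integral_eq_zero hp hvG.1 h_orth a).trans <|
    integral_norm_rpow_le_of_eLpNorm_le hp₀ hC.le (hvG.1.sub (memLp_const a)) hvG.2.1 ha

lemma eventually_inv_rpow_le_rayleighValues (hopen : IsOpen Ω) (hbdd : Bornology.IsBounded Ω)
    (hcone : UniformConeCondition Ω) {C : ℝ} (hC : intrinsicDiam Ω / 2 < ENNReal.ofReal C) :
    ∀ᶠ p : ℝ in atTop, ∀ r ∈ rayleighValues Ω p, C⁻¹ ^ p ≤ r := by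
  filter_upwards [eventually_exists_eLpNorm_sub_const_le hopen hbdd hcone hC,
    eventually_gt_atTop 1] with p h_poincare hp
  exact inv_rpow_le_of_mem_rayleighValues hbdd.measure_lt_top.ne hp
    (ENNReal.ofReal_pos.1 (pos_of_gt hC)) h_poincare

end LowerBound

section LocallyLipschitz

variable {V : Type*} [NormedAddCommGroup V] [NormedSpace ℝ V] [FiniteDimensional ℝ V]

lemma exists_lipschitzWith_eventuallyEq {Ω K : Set V} (hopen : IsOpen Ω) {v : V → ℝ}
    (hv : LocallyLipschitzOn Ω v) (hK : IsCompact K) (hKΩ : K ⊆ Ω) :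
    ∃ (C : NNReal) (g : V → ℝ), LipschitzWith C g ∧ ∀ x ∈ K, v =ᶠ[𝓝 x] g := by
  have := FiniteDimensional.proper ℝ V
  obtain ⟨δ, hδ, hδΩ⟩ := hK.exists_cthickening_subset_open hopen hKΩ
  obtain ⟨C, hC⟩ := (hv.mono hδΩ).exists_lipschitzOnWith_of_compact hK.cthickening
  obtain ⟨g, hg, hvg⟩ := hC.extend_real
  refine ⟨C, g, hg, fun x hx => ?_⟩
  filter_upwards [Metric.isOpen_thickening.mem_nhds (Metric.self_subset_thickening hδ K hx)]
    with y hy using hvg (Metric.thickening_subset_cthickening δ K hy)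

variable [MeasurableSpace V] [BorelSpace V] {μ : Measure V} [μ.IsAddHaarMeasure]

lemma integral_mul_fderiv_eq_of_lipschitzWith {C : NNReal} {g ψ : V → ℝ} (hg : LipschitzWith C g)
    (hψ : ContDiff ℝ 1 ψ) (hψc : HasCompactSupport ψ) (e : V) :
    ∫ x, g x * fderiv ℝ ψ x e ∂μ = -∫ x, fderiv ℝ g x e * ψ x ∂μ := by
  obtain ⟨C', hψ_lip⟩ := ContDiff.lipschitzWith_of_hasCompactSupport hψc hψ one_ne_zero
  calc ∫ x, g x * fderiv ℝ ψ x e ∂μ = -∫ x, lineDeriv ℝ ψ x (-e) * g x ∂μ := by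
        rw [← integral_neg]
        refine integral_congr_ae (.of_forall fun x => ?_)
        simp only [(hψ.differentiable one_ne_zero x).lineDeriv_eq_fderiv, map_neg]
        ring
    _ = -∫ x, fderiv ℝ g x e * ψ x ∂μ := by
        rw [← hg.integral_lineDeriv_mul_eq hψ_lip hψc e, integral_congr_ae]
        filter_upwards [hg.ae_differentiableAt (μ := μ)] with x hx
        rw [hx.lineDeriv_eq_fderiv]

lemma setIntegral_mul_fderiv_eq_of_locallyLipschitzOn {Ω : Set V} (hopen : IsOpen Ω) {v ψ : V → ℝ}
    (hv : LocallyLipschitzOn Ω v) (hψ : ContDiff ℝ 1 ψ) (hψc : HasCompactSupport ψ)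
    (hψΩ : tsupport ψ ⊆ Ω) (e : V) :
    ∫ x in Ω, v x * fderiv ℝ ψ x e ∂μ = -∫ x in Ω, fderiv ℝ v x e * ψ x ∂μ := by
  obtain ⟨C, g, hg, hvg⟩ := exists_lipschitzWith_eventuallyEq hopen hv hψc hψΩ
  have hψ_zero : ∀ x ∉ tsupport ψ, ψ x = 0 := fun x => image_eq_zero_of_notMem_tsupport
  have hfderiv_zero : ∀ x ∉ tsupport ψ, fderiv ℝ ψ x e = 0 := fun x hx => by
    rw [image_eq_zero_of_notMem_tsupport (notMem_subset (tsupport_fderiv_subset ℝ) hx),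
      zero_apply]
  have hv_eq : ∫ x in Ω, v x * fderiv ℝ ψ x e ∂μ = ∫ x, g x * fderiv ℝ ψ x e ∂μ := by
    rw [setIntegral_eq_integral_of_forall_compl_eq_zero fun x hx => by
      rw [hfderiv_zero x (notMem_subset hψΩ hx), mul_zero]]
    refine integral_congr_ae (.of_forall fun x => ?_)
    by_cases hx : x ∈ tsupport ψ
    · simp only [(hvg x hx).eq_of_nhds]
    · simp only [hfderiv_zero x hx, mul_zero]
  have hfderiv_eq : ∫ x in Ω, fderiv ℝ v x e * ψ x ∂μ = ∫ x, fderiv ℝ g x e * ψ x ∂μ := by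
    rw [setIntegral_eq_integral_of_forall_compl_eq_zero fun x hx => by
      rw [hψ_zero x (notMem_subset hψΩ hx), mul_zero]]
    refine integral_congr_ae (.of_forall fun x => ?_)
    by_cases hx : x ∈ tsupport ψ
    · simp only [(hvg x hx).fderiv_eq]
    · simp only [hψ_zero x hx, mul_zero]
  rw [hv_eq, hfderiv_eq, integral_mul_fderiv_eq_of_lipschitzWith hg hψ hψc]

end LocallyLipschitz

section TestFunctions

lemma norm_gradient_le_of_lipschitzOnWith {F : Type*} [NormedAddCommGroup F]
    [InnerProductSpace ℝ F] [CompleteSpace F] {u : F → ℝ} {x : F} {U : Set F} (hU : U ∈ 𝓝 x)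
    {K : NNReal} (hu : LipschitzOnWith K u U) : ‖gradient u x‖ ≤ K := by
  rw [gradient, LinearIsometryEquiv.norm_map]
  exact norm_fderiv_le_of_lipschitzOn ℝ hU hu

lemma measurable_gradient {F : Type*} [NormedAddCommGroup F] [InnerProductSpace ℝ F]
    [CompleteSpace F] [MeasurableSpace F] [BorelSpace F] (u : F → ℝ) : Measurable (gradient u) :=
  (InnerProductSpace.toDual ℝ F).symm.continuous.measurable.comp (measurable_fderiv ℝ u)

variable {n : ℕ} {Ω : Set (E n)} {u : E n → ℝ}

lemma hasWeakGradientOn_gradient (hopen : IsOpen Ω) (hu : LocallyLipschitzOn Ω u) :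
    HasWeakGradientOn Ω u (gradient u) := by
  refine ⟨hu.continuousOn.locallyIntegrableOn hopen.measurableSet, fun x hx => ?_,
    fun ψ hψ hψc hψΩ e => ?_⟩
  · obtain ⟨K, U, hU, hK⟩ := hu hx
    rw [hopen.nhdsWithin_eq hx] at hU ⊢
    exact (volume.finiteAt_nhds x).integrableAtFilter
      (measurable_gradient u).stronglyMeasurable.stronglyMeasurableAtFilter
      ⟨K, (eventually_mem_nhds_iff.2 hU).mono fun y hy => norm_gradient_le_of_lipschitzOnWith hy hK⟩
  · simp only [inner_gradient_left]
    exact setIntegral_mul_fderiv_eq_of_locallyLipschitzOn hopen hu (hψ.of_le (by simp)) hψc hψΩ e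

lemma memW1p_gradient (hopen : IsOpen Ω) (hΩ : volume Ω ≠ ⊤) {p : ℝ} {K : NNReal}
    (hu : ∀ x ∈ Ω, ∃ U ∈ 𝓝 x, LipschitzOnWith K u U) {M : ℝ} (hM : ∀ x ∈ Ω, |u x| ≤ M) :
    MemW1p Ω p u (gradient u) := by
  have : IsFiniteMeasure (volume.restrict Ω) := isFiniteMeasure_restrict.2 hΩ
  have hu_lip : LocallyLipschitzOn Ω u := fun x hx =>
    let ⟨U, hU, hK⟩ := hu x hx
    ⟨K, U, mem_nhdsWithin_of_mem_nhds hU, hK⟩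
  refine ⟨.of_bound (hu_lip.continuousOn.aestronglyMeasurable hopen.measurableSet) M
    (ae_restrict_of_forall_mem hopen.measurableSet hM),
    .of_bound (measurable_gradient u).aestronglyMeasurable K
      (ae_restrict_of_forall_mem hopen.measurableSet fun x hx => ?_),
    hasWeakGradientOn_gradient hopen hu_lip⟩
  obtain ⟨U, hU, hK⟩ := hu x hx
  exact norm_gradient_le_of_lipschitzOnWith hU hK

end TestFunctions

section Centering

variable {α : Type*} [MeasurableSpace α] {μ : Measure α} [IsFiniteMeasure μ]

lemma continuous_abs_rpow_sub_two_mul {p : ℝ} (hp : 1 < p) :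
    Continuous fun t : ℝ => |t| ^ (p - 2) * t := by
  have h_deriv : deriv (fun t : ℝ => ‖t‖ ^ p) = fun t => p * (|t| ^ (p - 2) * t) :=
    funext fun t => (hasDerivAt_abs_rpow t hp).deriv.trans (mul_assoc _ _ _)
  have h_cont := (contDiff_norm_rpow (E := ℝ) hp).continuous_deriv le_rfl
  rw [h_deriv] at h_cont
  simpa only [inv_mul_cancel_left₀ (one_pos.trans hp).ne'] using h_cont.const_mul p⁻¹

lemma exists_integral_abs_rpow_sub_two_mul_eq_zero {p : ℝ} (hp : 1 < p) {u : α → ℝ}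
    (hu : AEStronglyMeasurable u μ) {M : ℝ} (hM : ∀ᵐ x ∂μ, |u x| ≤ M) :
    ∃ c, ∫ x, |u x - c| ^ (p - 2) * (u x - c) ∂μ = 0 := by
  obtain ⟨R, hR₀, hR⟩ : ∃ R, 0 ≤ R ∧ ∀ᵐ x ∂μ, |u x| ≤ R :=
    ⟨|M|, abs_nonneg M, hM.mono fun x hx => hx.trans (le_abs_self M)⟩
  have h_cont : ContinuousOn (fun c => ∫ x, |u x - c| ^ (p - 2) * (u x - c) ∂μ) (Icc (-R) R) := by
    refine continuousOn_of_dominated (bound := fun _ => (2 * R) ^ (p - 1)) (fun c _ => ?_)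
      (fun c hc => ?_) (integrable_const _) (.of_forall fun x => ?_)
    · exact (continuous_abs_rpow_sub_two_mul hp).comp_aestronglyMeasurable
        (hu.sub aestronglyMeasurable_const)
    · filter_upwards [hR] with x hx
      rw [Real.norm_eq_abs, abs_abs_rpow_sub_two_mul hp.ne']
      refine Real.rpow_le_rpow (abs_nonneg _) ?_ (sub_pos.2 hp).le
      linarith [abs_sub (u x) c, abs_le.2 hc]
    · exact ((continuous_abs_rpow_sub_two_mul hp).comp (continuous_sub_left _)).continuousOn
  have h_nonneg : 0 ≤ ∫ x, |u x - -R| ^ (p - 2) * (u x - -R) ∂μ :=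
    integral_nonneg_of_ae <| hR.mono fun x hx =>
      mul_nonneg (by positivity) (sub_nonneg.2 (abs_le.1 hx).1)
  have h_nonpos : ∫ x, |u x - R| ^ (p - 2) * (u x - R) ∂μ ≤ 0 :=
    integral_nonpos_of_ae <| hR.mono fun x hx =>
      mul_nonpos_of_nonneg_of_nonpos (by positivity) (sub_nonpos.2 (abs_le.1 hx).2)
  obtain ⟨c, -, hc⟩ := intermediate_value_Icc' (neg_le_self hR₀) h_cont ⟨h_nonpos, h_nonneg⟩
  exact ⟨c, hc⟩

end Centering

section UpperBound

lemma measureReal_restrict_preimage_pos {X Y : Type*} [TopologicalSpace X] [MeasurableSpace X]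
    [OpensMeasurableSpace X] [TopologicalSpace Y] {μ : Measure X} [μ.IsOpenPosMeasure] {Ω : Set X}
    (hopen : IsOpen Ω) (hΩ : μ Ω ≠ ⊤) {u : X → Y} (hu : ContinuousOn u Ω) {O : Set Y}
    (hO : IsOpen O) {x : X} (hx : x ∈ Ω) (hux : u x ∈ O) :
    0 < (μ.restrict Ω).real (u ⁻¹' O) := by
  have : IsFiniteMeasure (μ.restrict Ω) := isFiniteMeasure_restrict.2 hΩ
  refine ENNReal.toReal_pos ?_ (measure_ne_top _ _)
  rw [Measure.restrict_apply' hopen.measurableSet, inter_comm]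
  exact ((hu.isOpen_inter_preimage hopen hO).measure_pos μ ⟨x, hx, hux⟩).ne'

lemma rpow_mul_measureReal_le_integral {α : Type*} [MeasurableSpace α] {μ : Measure α}
    [IsFiniteMeasure μ] {p : ℝ} (hp : 0 < p) {v : α → ℝ} (hv : MemLp v (ENNReal.ofReal p) μ)
    {s : ℝ} (hs : 0 ≤ s) {A : Set α} (hA : ∀ x ∈ A, s ≤ |v x|) :
    s ^ p * μ.real A ≤ ∫ x, |v x| ^ p ∂μ :=
  calc s ^ p * μ.real A ≤ s ^ p * μ.real {x | s ^ p ≤ |v x| ^ p} := by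
        refine mul_le_mul_of_nonneg_left (measureReal_mono fun x hx => ?_) (by positivity)
        exact Real.rpow_le_rpow hs (hA x hx) hp.le
    _ ≤ ∫ x, |v x| ^ p ∂μ :=
        mul_meas_ge_le_integral_of_nonneg (.of_forall fun x => by positivity)
          (integrable_norm_rpow_of_memLp hp hv) _

lemma exists_rpow_mul_le_integral_sub_const {X : Type*} [TopologicalSpace X] [MeasurableSpace X]
    [OpensMeasurableSpace X] {μ : Measure X} [μ.IsOpenPosMeasure] {Ω : Set X} (hopen : IsOpen Ω)
    (hΩ : μ Ω ≠ ⊤) {u : X → ℝ} (hu : ContinuousOn u Ω) {x y : X} (hx : x ∈ Ω) (hy : y ∈ Ω)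
    {s : ℝ} (hs : 0 ≤ s) (hxy : 2 * s < u y - u x) :
    ∃ m > 0, ∀ p > 0, ∀ c : ℝ, MemLp (fun z => u z - c) (ENNReal.ofReal p) (μ.restrict Ω) →
      s ^ p * m ≤ ∫ z in Ω, |u z - c| ^ p ∂μ := by
  have : IsFiniteMeasure (μ.restrict Ω) := isFiniteMeasure_restrict.2 hΩ
  obtain ⟨t, hxt, hty⟩ : ∃ t, u x + s < t ∧ t < u y - s := exists_between (by linarith)
  set A := u ⁻¹' Iio (t - s)
  set B := u ⁻¹' Ioi (t + s)
  refine ⟨min ((μ.restrict Ω).real A) ((μ.restrict Ω).real B), lt_min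
    (measureReal_restrict_preimage_pos hopen hΩ hu isOpen_Iio hx (lt_sub_iff_add_lt.2 hxt))
    (measureReal_restrict_preimage_pos hopen hΩ hu isOpen_Ioi hy (lt_sub_iff_add_lt.1 hty)),
    fun p hp c hc => ?_⟩
  have h_bound : ∀ A' : Set X, (∀ z ∈ A', s ≤ |u z - c|) →
      s ^ p * (μ.restrict Ω).real A' ≤ ∫ z in Ω, |u z - c| ^ p ∂μ := fun A' =>
    rpow_mul_measureReal_le_integral hp hc hs
  rcases le_total t c with htc | hct
  · refine le_trans (by gcongr; exact min_le_left _ _) (h_bound A fun z hz => ?_)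
    linarith [neg_abs_le (u z - c), (show u z < t - s from hz)]
  · refine le_trans (by gcongr; exact min_le_right _ _) (h_bound B fun z hz => ?_)
    linarith [le_abs_self (u z - c), (show t + s < u z from hz)]

variable {n : ℕ} {Ω : Set (E n)}

lemma exists_rayleighValues_le_div (hopen : IsOpen Ω) (hΩ : volume Ω ≠ ⊤) {u : E n → ℝ}
    (hu : ∀ x ∈ Ω, ∃ U ∈ 𝓝 x, LipschitzOnWith 1 u U) {M : ℝ} (hM : ∀ x ∈ Ω, |u x| ≤ M)
    {x y : E n} (hx : x ∈ Ω) (hy : y ∈ Ω) {s : ℝ} (hs : 0 < s) (hxy : 2 * s < u y - u x) :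
    ∃ Q, ∀ p > 1, ∃ r ∈ rayleighValues Ω p, r ≤ Q / s ^ p := by
  have : IsFiniteMeasure (volume.restrict Ω) := isFiniteMeasure_restrict.2 hΩ
  have hu_cont : ContinuousOn u Ω := fun z hz =>
    let ⟨_, hU, hL⟩ := hu z hz
    (hL.continuousOn.continuousAt hU).continuousWithinAt
  obtain ⟨m, hm, h_den⟩ := exists_rpow_mul_le_integral_sub_const hopen hΩ hu_cont hx hy hs.le hxy
  refine ⟨volume.real Ω / m, fun p hp => ?_⟩
  have hp₀ : 0 < p := one_pos.trans hp
  obtain ⟨c, hc⟩ := exists_integral_abs_rpow_sub_two_mul_eq_zero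
    (μ := volume.restrict Ω) hp (hu_cont.aestronglyMeasurable hopen.measurableSet)
    (ae_restrict_of_forall_mem hopen.measurableSet hM)
  set v : E n → ℝ := fun z => u z - c
  have hv : ∀ z ∈ Ω, ∃ U ∈ 𝓝 z, LipschitzOnWith 1 v U := fun z hz =>
    let ⟨U, hU, hL⟩ := hu z hz
    ⟨U, hU, .of_dist_le_mul fun a ha b hb => by
      simpa only [v, dist_sub_right] using hL.dist_le_mul a ha b hb⟩
  have hvW : MemW1p Ω p v (gradient v) := memW1p_gradient hopen hΩ hv fun z hz =>
    (abs_sub (u z) c).trans (add_le_add_left (hM z hz) |c|)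
  have h_num : ∫ z in Ω, ‖gradient v z‖ ^ p ≤ volume.real Ω := by
    refine (Real.le_norm_self _).trans ((norm_setIntegral_le_of_norm_le_const (C := 1) hΩ.lt_top
      fun z hz => ?_).trans_eq (one_mul _))
    obtain ⟨U, hU, hL⟩ := hv z hz
    rw [Real.norm_of_nonneg (by positivity)]
    exact Real.rpow_le_one (norm_nonneg _) (norm_gradient_le_of_lipschitzOnWith hU hL) hp₀.le
  have h_den_pos : 0 < s ^ p * m := by positivity
  refine ⟨_, ⟨v, gradient v, hvW, fun hv₀ => ?_, hc, rfl⟩, ?_⟩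
  · refine (h_den_pos.trans_le (h_den p hp₀ c hvW.1)).ne' (integral_eq_zero_of_ae ?_)
    exact hv₀.mono fun z hz => by
      simpa only [v, Pi.zero_apply, hz, abs_zero] using Real.zero_rpow hp₀.ne'
  · rw [div_div, mul_comm m]
    exact div_le_div₀ measureReal_nonneg h_num h_den_pos (h_den p hp₀ c hvW.1)

lemma exists_rayleighValues_le_div_of_lt_intrinsicDiam (hopen : IsOpen Ω)
    (hbdd : Bornology.IsBounded Ω) (hconn : IsPreconnected Ω) (hfin : intrinsicDiam Ω ≠ ⊤) {s : ℝ}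
    (hs : 0 < s) (hs' : ENNReal.ofReal (2 * s) < intrinsicDiam Ω) :
    ∃ Q, ∀ p > 1, ∃ r ∈ rayleighValues Ω p, r ≤ Q / s ^ p := by
  obtain ⟨x, hx, y, hy, hxy⟩ :
      ∃ x ∈ Ω, ∃ y ∈ Ω, ENNReal.ofReal (2 * s) < intrinsicDist Ω x y := by
    simpa only [intrinsicDiam, lt_iSup_iff, exists_prop] using hs'
  have h_self : intrinsicDist Ω x x = 0 := by
    have h_le := intrinsicDist_le_edist (Ω := Ω) (x := x) (y := x)
      (by rwa [segment_same, singleton_subset_iff])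
    rwa [edist_self, nonpos_iff_eq_zero] at h_le
  refine exists_rayleighValues_le_div (u := fun z => (intrinsicDist Ω x z).toReal) hopen
    hbdd.measure_lt_top.ne
    (fun z hz => exists_lipschitzOnWith_toReal_intrinsicDist hopen hconn hx hz)
    (M := (intrinsicDiam Ω).toReal) (fun z hz => ?_) hx hy hs ?_
  · rw [abs_of_nonneg ENNReal.toReal_nonneg]
    exact ENNReal.toReal_mono hfin (intrinsicDist_le_intrinsicDiam hx hz)
  · rw [h_self, ENNReal.toReal_zero, sub_zero]
    exact (ENNReal.ofReal_lt_iff_lt_toReal (by positivity)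
      (ne_top_of_le_ne_top hfin (intrinsicDist_le_intrinsicDiam hx hy))).1 hxy

lemma eventually_exists_rayleighValues_le (hopen : IsOpen Ω) (hbdd : Bornology.IsBounded Ω)
    (hconn : IsPreconnected Ω) (hfin : intrinsicDiam Ω ≠ ⊤) {C : ℝ} (hC₀ : 0 < C)
    (hC : 2 * C < (intrinsicDiam Ω).toReal) :
    ∀ᶠ p : ℝ in atTop, ∃ r ∈ rayleighValues Ω p, r ≤ C⁻¹ ^ p := by
  obtain ⟨s, hCs, hs⟩ : ∃ s, C < s ∧ s < (intrinsicDiam Ω).toReal / 2 :=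
    exists_between (by linarith)
  have hs₀ : 0 < s := hC₀.trans hCs
  obtain ⟨Q, hQ⟩ := exists_rayleighValues_le_div_of_lt_intrinsicDiam hopen hbdd hconn hfin hs₀
    ((ENNReal.ofReal_lt_iff_lt_toReal (by positivity) hfin).2 (by linarith))
  have h_pow := tendsto_rpow_atTop_of_base_gt_one (s / C) ((one_lt_div hC₀).2 hCs)
  filter_upwards [h_pow.eventually_ge_atTop Q, eventually_gt_atTop 1] with p hQp hp
  obtain ⟨r, hr, hrQ⟩ := hQ p hp
  refine ⟨r, hr, hrQ.trans ?_⟩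
  rwa [div_le_iff₀ (by positivity), ← Real.mul_rpow (by positivity) hs₀.le, inv_mul_eq_div]

end UpperBound

section Limit

variable {n : ℕ} {Ω : Set (E n)} {p a : ℝ}

lemma nonneg_of_mem_rayleighValues {r : ℝ} (hr : r ∈ rayleighValues Ω p) : 0 ≤ r := by
  obtain ⟨v, G, -, -, -, rfl⟩ := hr
  positivity

lemma le_neumannLambda (hp : 0 < p) (ha : 0 ≤ a) (h_nonempty : (rayleighValues Ω p).Nonempty)
    (h : ∀ r ∈ rayleighValues Ω p, a ^ p ≤ r) : a ≤ neumannLambda Ω p := by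
  rw [neumannLambda, neumannEigenvalue, one_div, Real.le_rpow_inv_iff_of_pos ha
    (Real.sInf_nonneg fun _ => nonneg_of_mem_rayleighValues) hp]
  exact le_csInf h_nonempty h

lemma neumannLambda_le (hp : 0 < p) (ha : 0 ≤ a) {r : ℝ} (hr : r ∈ rayleighValues Ω p)
    (hra : r ≤ a ^ p) : neumannLambda Ω p ≤ a := by
  rw [neumannLambda, neumannEigenvalue, one_div, Real.rpow_inv_le_iff_of_pos
    (Real.sInf_nonneg fun _ => nonneg_of_mem_rayleighValues) ha hp]
  exact (csInf_le ⟨0, fun _ => nonneg_of_mem_rayleighValues⟩ hr).trans hra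

lemma tendsto_neumannLambda (hopen : IsOpen Ω) (hbdd : Bornology.IsBounded Ω)
    (hconn : IsPreconnected Ω) (hcone : UniformConeCondition Ω) (hpos : 0 < intrinsicDiam Ω)
    (hfin : intrinsicDiam Ω ≠ ⊤) :
    Tendsto (neumannLambda Ω) atTop (𝓝 (2 / (intrinsicDiam Ω).toReal)) := by
  set D := (intrinsicDiam Ω).toReal
  have hD₀ : 0 < D / 2 := half_pos (ENNReal.toReal_pos hpos.ne' hfin)
  have h_upper {C : ℝ} (hC₀ : 0 < C) (hC : C < D / 2) :=
    eventually_exists_rayleighValues_le hopen hbdd hconn hfin hC₀ (by linarith : 2 * C < D)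
  have h_inv : Tendsto (fun C : ℝ => C⁻¹) (𝓝 (D / 2)) (𝓝 (2 / D)) := by
    simpa only [inv_div] using tendsto_inv₀ hD₀.ne'
  refine tendsto_order.2 ⟨fun a ha => ?_, fun b hb => ?_⟩
  · obtain ⟨C, haC, hDC⟩ := (((h_inv.mono_left nhdsWithin_le_nhds).eventually_const_lt ha).and
      (self_mem_nhdsWithin : Ioi (D / 2) ∈ 𝓝[>] (D / 2))).exists
    have hC : intrinsicDiam Ω / 2 < ENNReal.ofReal C := by
      rwa [← ENNReal.ofReal_toReal hfin, ← ENNReal.ofReal_ofNat,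
        ← ENNReal.ofReal_div_of_pos two_pos, ENNReal.ofReal_lt_ofReal_iff (hD₀.trans hDC)]
    filter_upwards [eventually_inv_rpow_le_rayleighValues hopen hbdd hcone hC,
      h_upper (half_pos hD₀) (half_lt_self hD₀), eventually_gt_atTop 0] with p h_lower ⟨r, hr, _⟩ hp
    exact haC.trans_le (le_neumannLambda hp (inv_nonneg.2 (hD₀.trans hDC).le) ⟨r, hr⟩ h_lower)
  · obtain ⟨C, ⟨hCb, hC₀⟩, hCD⟩ := ((((h_inv.eventually_lt_const hb).and
      (eventually_gt_nhds hD₀)).filter_mono nhdsWithin_le_nhds).and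
      (self_mem_nhdsWithin : Iio (D / 2) ∈ 𝓝[<] (D / 2))).exists
    filter_upwards [h_upper hC₀ hCD, eventually_gt_atTop 0] with p ⟨r, hr, hrC⟩ hp
    exact (neumannLambda_le hp (inv_nonneg.2 hC₀.le) hr hrC).trans_lt hCb

end Limit

end NeumannPLaplace

open NeumannPLaplace in
theorem lemma5p4_general {n : ℕ} (hn : 1 ≤ n) (Ω : Set (E n)) (hopen : IsOpen Ω)
    (hbdd : Bornology.IsBounded Ω) (hconn : IsConnected Ω) (hcone : UniformConeCondition Ω) :
    0 < intrinsicDiam Ω ∧ intrinsicDiam Ω < ⊤ ∧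
      Tendsto (fun p : ℝ => neumannLambda Ω p) atTop (𝓝 (2 / (intrinsicDiam Ω).toReal)) := by
  have : Nonempty (Fin n) := ⟨⟨0, hn⟩⟩
  have h_pos : 0 < intrinsicDiam Ω := intrinsicDiam_pos hopen hconn.nonempty
  have h_fin : intrinsicDiam Ω < ⊤ := intrinsicDiam_lt_top hopen hbdd hconn hcone
  exact ⟨h_pos, h_fin,
    tendsto_neumannLambda hopen hbdd hconn.isPreconnected hcone h_pos h_fin.ne⟩

theorem lemma5p4 {n : ℕ} (hn : 1 ≤ n) (Ω : Set (NeumannPLaplace.E n))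
    (hopen : IsOpen Ω) (hbdd : Bornology.IsBounded Ω) (hsc : IsSimplyConnected Ω)
    (hLip : NeumannPLaplace.HasLipschitzBoundary Ω) :
    0 < NeumannPLaplace.intrinsicDiam Ω ∧ NeumannPLaplace.intrinsicDiam Ω < ⊤ ∧
      Tendsto (fun p : ℝ => NeumannPLaplace.neumannLambda Ω p) atTop
        (𝓝 (2 / (NeumannPLaplace.intrinsicDiam Ω).toReal)) :=
  lemma5p4_general hn Ω hopen hbdd hsc.isPathConnected.isConnected
    (hLip.uniformConeCondition hopen hbdd)
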